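/- For a group $G$ generated by a finite set $X$, let $B_G^X(n)$ be the closed ball of radius $n$ about the identity in the word metric given by $X$, and let $\Phi_G^X(n)$ be the minimal order of a group $Q$ for which there is a homomorphism $G\to Q$ that is injective on $B_G^X(n)$. For functions $f,g$ of positive integers write $f\preceq g$ if there is a constant $C$ such that $f(n)\le C\,g(Cn)$ for all positive integers $n$. Put $\gamma_1(G)=G$ and $\gamma_{k+1}(G)=[\gamma_k(G),G]$; a nilpotent group $G$ is of class $c$ if $\gamma_{c+1}(G)=1$ and $c$ is minimal with this property. The dimension $\dim(G)$ of a finitely generated nilpotent group $G$ is the number of infinite factors in any subnormal series of $G$ with cyclic factors (it does not depend on the series). Theorem. Let $G$ be a finitely generated nilpotent group of class $c$. Let $1=H_0\le H_1\le\dots\le H_{c-1}\le G$ be a terraced filtration of $G$, that is, a chain of subgroups such that each $H_i$ ($0\le i\le c-1$) is maximal among the normal subgroups $K$ of $G$ with $K\cap\gamma_{i+1}(G)=1$. Then, for every finite generating set $X$ of $G$, $$\Phi_G^X(n)\preceq n^{\,c\dim(G)-\sum_{i=1}^{c-1}\dim(H_i)}.$$ -/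

import Mathlib

open scoped ENNReal

/-- The closed ball of radius `n` about `1` in `G` for the word metric given by `X`: the products of
at most `n` factors, each of which is an element of `X` or the inverse of an element of `X`. -/
def wordBall {G : Type*} [Group G] (X : Finset G) (n : ℕ) : Set G :=
  {g | ∃ l : List G, l.length ≤ n ∧ (∀ x ∈ l, x ∈ X ∨ x⁻¹ ∈ X) ∧ l.prod = g}

/-- `S ⊆ G` is fully detected by the group `Q` if some homomorphism `G → Q` is injective on `S`. -/
def FullyDetects {G : Type*} [Group G] (Q : Type*) [Group Q] (S : Set G) : Prop :=
  ∃ φ : G →* Q, Set.InjOn φ S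

/-- The function `Φ_G^X`: the minimal order of a group that fully detects the ball of radius `n`.
It takes the value `⊤` if no finite group fully detects that ball, so that an upper bound by a
finite number includes the existence of a finite group that does. (Every finite group is isomorphic
to one in `Type`.) -/
noncomputable def fullRFGrowth {G : Type*} [Group G] (X : Finset G) (n : ℕ) : ℕ∞ :=
  sInf {k : ℕ∞ | ∃ (Q : Type) (_ : Group Q), FullyDetects Q (wordBall X n) ∧ ENat.card Q = k}

/-- `f ⪯ g`: there is a constant `C` with `f(n) ≤ C g(Cn)` for all positive integers `n`. -/
def GrowthLE (f g : ℕ → ℝ≥0∞) : Prop :=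
  ∃ C : ℕ, 0 < C ∧ ∀ n : ℕ, 0 < n → f n ≤ C * g (C * n)

/-- `G = S 0 ≥ S 1 ≥ ⋯ ≥ S n = 1` is a subnormal series of `G` with cyclic factors. -/
structure IsCyclicSeries {G : Type*} [Group G] (n : ℕ) (S : ℕ → Subgroup G) : Prop where
  zero_eq : S 0 = ⊤
  last_eq : S n = ⊥
  succ_le : ∀ i < n, S (i + 1) ≤ S i
  cyclic : ∀ i < n, ∃ _ : ((S (i + 1)).subgroupOf (S i)).Normal,
    IsCyclic (S i ⧸ (S (i + 1)).subgroupOf (S i))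

open Classical in
/-- The dimension (Hirsch length) of a group that has a subnormal series with cyclic factors, such
as a finitely generated nilpotent group: the number of infinite factors of such a series. This
number is the same for all such series of `G`; the infimum serves to pick it out. -/
noncomputable def groupDim (G : Type*) [Group G] : ℕ :=
  sInf {d : ℕ | ∃ (n : ℕ) (S : ℕ → Subgroup G), IsCyclicSeries n S ∧
    ((Finset.range n).filter fun i => Infinite (S i ⧸ (S (i + 1)).subgroupOf (S i))).card = d}

/-- A terraced filtration `1 = H 0 ≤ H 1 ≤ ⋯ ≤ H (c - 1) ≤ G`: each `H i` is maximal among the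
normal subgroups of `G` that meet `γ_{i+1}(G)` trivially. Mathlib numbers the lower central series
from `0`, so that `γ_{i+1}(G)` is its `i`-th term. -/
structure IsTerracedFiltration {G : Type*} [Group G] (c : ℕ) (H : ℕ → Subgroup G) : Prop where
  zero_eq : H 0 = ⊥
  le_succ : ∀ i, i + 1 < c → H i ≤ H (i + 1)
  maximal : ∀ i < c, Maximal
    (fun K : Subgroup G => K.Normal ∧ K ⊓ (⊤ : Subgroup G).lowerCentralSeries i = ⊥) (H i)

/-! Write `lcs i` for the lower central series numbered from `0`, and put `H c = G`. Let `N`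
(`powProduct`) be the product of the subgroups generated by the `q ^ i`-th powers of elements of `H
i`, `1 ≤ i ≤ c`. It suffices that for some `q` proportional to `n` this normal subgroup meets the
ball of radius `2n` trivially, and that its index is `O(q ^ E)` with `E` at most the stated
exponent.

Index (`IsTerrace.exists_card_quotient_powProduct_le`): take a cyclic series realising `dim G`. An
infinite factor in which `H i` is the first terrace with nontrivial image contributes `O(q ^ i)` to
`|G / N|`. Since `dim (H l)` is at most the number of factors already reached by `H l`, summing
these levels gives the exponent.

Intersection (`IsTerrace.exists_powProduct_inter_wordBall`): commutators with generators turn a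
nontrivial element of `N` in the ball into a nontrivial central one, `z`, in a ball larger by a
constant factor. A Hall–Petrescu argument turns products of powers into powers, so the top factor of
`z` is a power of some `y ∈ H (i + 1)`, the rest lying in `H i`. As `z` is central, that power is
central modulo `H i`, and maximality of `H i` puts a bounded power of `y` into `lcs i * H i`. Its
component in `lcs i` lies in `H (i + 1)` and is therefore central. By induction `z` is a product of
`a j ^ m ^ (j + 1)` with `a j ∈ lcs j ⊓ H (j + 1)`.

But an element of the ball in `lcs j` has coordinates `O(n ^ (j + 1))` modulo `lcs (j + 1)`. For `m`
large compared to `n` this makes `a 0` torsion modulo `lcs 1`, hence torsion because `H 1` meets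
`lcs 1` trivially, and its power dies if `m` is divisible enough. Repeating this with `a 1, a 2, …`
gives `z = 1`. -/

open scoped commutatorElement

/-! ### Group filtrations and their derived filtrations -/

section Filtrations

/-- A descending chain of subgroups with `[F i, F j] ≤ F (i + j)`. -/
structure IsGroupFiltration {A : Type*} [Group A] (F : ℕ → Subgroup A) : Prop where
  anti : Antitone F
  comm : ∀ i j, ∀ x ∈ F i, ∀ y ∈ F j, ⁅x, y⁆ ∈ F (i + j)

theorem IsGroupFiltration.conj_mem {A : Type*} [Group A] {F : ℕ → Subgroup A}
    (hF : IsGroupFiltration F) {i : ℕ} {x g : A} (hx : x ∈ F i) (hg : g ∈ F 0) :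
    g * x * g⁻¹ ∈ F i := by
  have h := hF.comm 0 i g hg x hx
  rw [zero_add] at h
  have := mul_mem h hx
  simpa [commutatorElement_def] using this

theorem IsGroupFiltration.conj_mem' {A : Type*} [Group A] {F : ℕ → Subgroup A}
    (hF : IsGroupFiltration F) {i : ℕ} {x g : A} (hx : x ∈ F i) (hg : g ∈ F 0) :
    g⁻¹ * x * g ∈ F i := by
  simpa using hF.conj_mem hx (inv_mem hg)

/-- The elements of `F k` that an endomorphism `σ` moves by an element of `F (k + 1)`. -/
def derivedFiltration {A : Type*} [Group A] {F : ℕ → Subgroup A}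
    (hF : IsGroupFiltration F) (σ : A →* A) (k : ℕ) : Subgroup A where
  carrier := {f | f ∈ F k ∧ f⁻¹ * σ f ∈ F (k + 1)}
  one_mem' := by simp
  mul_mem' := by
    rintro f g ⟨hf, hf'⟩ ⟨hg, hg'⟩
    refine ⟨mul_mem hf hg, ?_⟩
    have h := mul_mem (hF.conj_mem' hf' (hF.anti (Nat.zero_le k) hg)) hg'
    have e : (f * g)⁻¹ * σ (f * g) = g⁻¹ * (f⁻¹ * σ f) * g * (g⁻¹ * σ g) := by
      rw [map_mul]; group
    rwa [e]
  inv_mem' := by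
    rintro f ⟨hf, hf'⟩
    refine ⟨inv_mem hf, ?_⟩
    have h := hF.conj_mem (inv_mem hf') (hF.anti (Nat.zero_le k) hf)
    have e : f⁻¹⁻¹ * σ f⁻¹ = f * (f⁻¹ * σ f)⁻¹ * f⁻¹ := by
      rw [map_inv]; group
    rwa [e]

/-- With `σ f = f * a` and `σ g = g * b`, the displacement of `⁅f, g⁆` is a product of conjugates of
`⁅a, g⁆`, `⁅a, b⁆` and `⁅f, b⁆`, each one step deeper. This is what allows the construction to be
iterated. -/
theorem isGroupFiltration_derivedFiltration {A : Type*} [Group A] {F : ℕ → Subgroup A}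
    (hF : IsGroupFiltration F) (σ : A →* A) : IsGroupFiltration (derivedFiltration hF σ) where
  anti := fun i j hij f hf => ⟨hF.anti hij hf.1, hF.anti (by omega) hf.2⟩
  comm := by
    rintro i j f ⟨hf, ha⟩ g ⟨hg, hb⟩
    refine ⟨hF.comm i j f hf g hg, ?_⟩
    set a := f⁻¹ * σ f with hadef
    set b := g⁻¹ * σ g with hbdef
    have hf0 := hF.anti (Nat.zero_le i) hf
    have hg0 := hF.anti (Nat.zero_le j) hg
    have h1 : ⁅a, g⁆ ∈ F (i + j + 1) := by
      have := hF.comm _ _ a ha g hg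
      rwa [show i + 1 + j = i + j + 1 by omega] at this
    have h2 : ⁅a, b⁆ ∈ F (i + j + 1) := hF.anti (by omega) (hF.comm _ _ a ha b hb)
    have h3 : ⁅f, b⁆ ∈ F (i + j + 1) := hF.comm _ _ f hf b hb
    have h4 : ⁅f, g⁆ ∈ F 0 := hF.anti (Nat.zero_le _) (hF.comm _ _ f hf g hg)
    have n1 := hF.conj_mem (mul_mem h1 (hF.conj_mem h2 hg0)) hf0
    have n2 := hF.conj_mem h3 hg0
    have h := mul_mem (hF.conj_mem' n1 h4) n2
    have e : ⁅f, g⁆⁻¹ * σ ⁅f, g⁆ =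
        ⁅f, g⁆⁻¹ * (f * (⁅a, g⁆ * (g * ⁅a, b⁆ * g⁻¹)) * f⁻¹) * ⁅f, g⁆ * (g * ⁅f, b⁆ * g⁻¹) := by
      have hs : σ f = f * a := by simp [hadef]
      have ht : σ g = g * b := by simp [hbdef]
      rw [map_commutatorElement, hs, ht]
      simp only [commutatorElement_def]
      group
    rwa [e]

/-- The three subgroups lemma, applied in the quotient by `N`. -/
theorem commutator_commutator_le_of_rotate {G : Type*} [Group G] {H₁ H₂ H₃ N : Subgroup G}
    [N.Normal] (h1 : ⁅⁅H₂, H₃⁆, H₁⁆ ≤ N) (h2 : ⁅⁅H₃, H₁⁆, H₂⁆ ≤ N) : ⁅⁅H₁, H₂⁆, H₃⁆ ≤ N := by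
  have key : ∀ K : Subgroup G, K ≤ N ↔ K.map (QuotientGroup.mk' N) = ⊥ := by
    intro K
    rw [Subgroup.map_eq_bot_iff, QuotientGroup.ker_mk']
  rw [key] at h1 h2 ⊢
  simp only [Subgroup.map_commutator] at h1 h2 ⊢
  exact Subgroup.commutator_commutator_eq_bot_of_rotate h1 h2

theorem commutator_lowerCentralSeries_le {G : Type*} [Group G] (i j : ℕ) :
    ⁅(⊤ : Subgroup G).lowerCentralSeries i, (⊤ : Subgroup G).lowerCentralSeries j⁆ ≤
      (⊤ : Subgroup G).lowerCentralSeries (i + j + 1) := by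
  induction j generalizing i with
  | zero => rw [Subgroup.lowerCentralSeries_succ]; simp
  | succ j ih =>
    rw [Subgroup.commutator_comm, Subgroup.lowerCentralSeries_succ _ j]
    apply commutator_commutator_le_of_rotate
    · rw [Subgroup.commutator_comm ⊤, ← Subgroup.lowerCentralSeries_succ]
      refine (ih (i + 1)).trans (le_of_eq ?_)
      congr 1; omega
    · refine (Subgroup.commutator_mono (ih i) le_rfl).trans (le_of_eq ?_)
      rw [← Subgroup.lowerCentralSeries_succ]
      congr 1

/-- The truncated `k - 1` makes the terms of index `0` and `1` both equal to `G`, so that `n ↦ a ^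
n` is polynomial for every `a`. -/
theorem isGroupFiltration_lowerCentralSeries (G : Type*) [Group G] :
    IsGroupFiltration fun k => (⊤ : Subgroup G).lowerCentralSeries (k - 1) where
  anti := fun _ _ h => Subgroup.lowerCentralSeries_antitone _ (Nat.sub_le_sub_right h 1)
  comm := fun i j x hx y hy => Subgroup.lowerCentralSeries_antitone _ (by omega)
    (commutator_lowerCentralSeries_le (i - 1) (j - 1) (Subgroup.commutator_mem_commutator hx hy))

end Filtrations

/-! ### Polynomial sequences (Lazard–Leibman) and Taylor expansion -/

section PolynomialSequences

/-- The shift of sequences in a group. -/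
def shiftHom (G : Type*) [Group G] : (ℕ → G) →* (ℕ → G) where
  toFun f n := f (n + 1)
  map_one' := rfl
  map_mul' _ _ := rfl

theorem isGroupFiltration_pi {G : Type*} [Group G] {F : ℕ → Subgroup G}
    (hF : IsGroupFiltration F) :
    IsGroupFiltration fun k => Subgroup.pi Set.univ fun _ : ℕ => F k where
  anti := fun _ _ h _ hf n hn => hF.anti h (hf n hn)
  comm := fun i j _ hx _ hy n hn => hF.comm i j _ (hx n hn) _ (hy n hn)

/-- The iterated derived filtrations of the sequences in a filtered group. -/
def polySeqAux {G : Type*} [Group G] {F : ℕ → Subgroup G} (hF : IsGroupFiltration F) :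
    ℕ → {P : ℕ → Subgroup (ℕ → G) // IsGroupFiltration P}
  | 0 => ⟨_, isGroupFiltration_pi hF⟩
  | d + 1 => ⟨_, isGroupFiltration_derivedFiltration (polySeqAux hF d).2 (shiftHom G)⟩

/-- The polynomial sequences in a filtered group: the `j`-th derivative of a member of
`polySeq hF k` takes values in `F (k + j)`. -/
def polySeq {G : Type*} [Group G] {F : ℕ → Subgroup G} (hF : IsGroupFiltration F) (k : ℕ) :
    Subgroup (ℕ → G) := ⨅ d, (polySeqAux hF d).1 k

/-- By Pascal's rule the derivative of `a ^ n.choose (j + 1)` is `a ^ n.choose j`. -/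
theorem pow_choose_mem_polySeqAux {G : Type*} [Group G] {F : ℕ → Subgroup G}
    (hF : IsGroupFiltration F) (d : ℕ) :
    ∀ (j k : ℕ) {a : G}, a ∈ F (j + k) →
      (fun n => a ^ n.choose j) ∈ (polySeqAux hF d).1 k := by
  induction d with
  | zero =>
    intro j k a ha n _
    exact pow_mem (hF.anti (by omega) ha) _
  | succ d ih =>
    intro j k a ha
    refine ⟨ih j k ha, ?_⟩
    cases j with
    | zero =>
      have e : (fun n : ℕ => a ^ n.choose 0)⁻¹ * shiftHom G (fun n => a ^ n.choose 0) = 1 := by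
        funext n; simp [shiftHom]
      rw [e]
      exact one_mem _
    | succ j =>
      convert ih j (k + 1) (a := a) (by rwa [show j + (k + 1) = j + 1 + k by omega]) using 1
      funext n
      simp only [shiftHom, MonoidHom.coe_mk, OneHom.coe_mk, Pi.mul_apply, Pi.inv_apply]
      rw [Nat.choose_succ_succ, add_comm (n.choose j), pow_add, Nat.succ_eq_add_one,
        inv_mul_cancel_left]

theorem pow_choose_mem_polySeq {G : Type*} [Group G] {F : ℕ → Subgroup G}
    (hF : IsGroupFiltration F) {j k : ℕ} {a : G} (ha : a ∈ F (j + k)) :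
    (fun n => a ^ n.choose j) ∈ polySeq hF k :=
  Subgroup.mem_iInf.2 fun d => pow_choose_mem_polySeqAux hF d j k ha

/-- The first possibly nontrivial value of a sequence is also that of its derivative, one place
earlier, and each derivative gains one step in the filtration. -/
theorem apply_mem_of_mem_polySeqAux {G : Type*} [Group G] {F : ℕ → Subgroup G}
    (hF : IsGroupFiltration F) (j : ℕ) :
    ∀ (k : ℕ) {f : ℕ → G}, f ∈ (polySeqAux hF j).1 k → (∀ n < j, f n = 1) → f j ∈ F (k + j) := by
  induction j with
  | zero => intro k f hf _; exact hf 0 trivial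
  | succ j ih =>
    intro k f hf h
    have := ih (k + 1) hf.2 (fun n hn => by
      simp [shiftHom, h n (by omega), h (n + 1) (by omega)])
    simpa [shiftHom, h j (by omega), show k + 1 + j = k + (j + 1) by omega] using this

theorem apply_mem_of_mem_polySeq {G : Type*} [Group G] {F : ℕ → Subgroup G}
    (hF : IsGroupFiltration F) {j : ℕ} {f : ℕ → G} (hf : f ∈ polySeq hF 0)
    (h : ∀ n < j, f n = 1) : f j ∈ F j := by
  have := apply_mem_of_mem_polySeqAux hF j 0 (Subgroup.mem_iInf.1 hf j) h
  rwa [zero_add] at this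

/-- Taylor expansion: at an `n` for which `Q` divides the relevant binomial coefficients, a
polynomial sequence is a product of boundedly many `Q`-th powers. -/
theorem exists_prod_pow_eq_of_mem_polySeq {G : Type*} [Group G] {F : ℕ → Subgroup G}
    (hF : IsGroupFiltration F) {c : ℕ} (hc : F (c + 1) = ⊥) (K : Subgroup G) {n Q : ℕ}
    (hQ : ∀ i, 1 ≤ i → i ≤ c → Q ∣ n.choose i) (r : ℕ) :
    ∀ {f : ℕ → G}, f ∈ polySeq hF 0 → (∀ n, f n ∈ K) → ∀ {j : ℕ}, 1 ≤ j → c + 1 ≤ j + r →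
      (∀ n < j, f n = 1) →
      ∃ l : List G, l.length ≤ r ∧ (∀ a ∈ l, a ∈ K) ∧ f n = (l.map (· ^ Q)).prod := by
  induction r with
  | zero =>
    intro f hf _ j _ hj h
    refine ⟨[], le_rfl, by simp, ?_⟩
    suffices ∀ m, f m = 1 by simp [this]
    intro m
    induction m using Nat.strong_induction_on with
    | _ m ih =>
      by_cases hm : m < j
      · exact h m hm
      have := hF.anti (show c + 1 ≤ m by omega) (apply_mem_of_mem_polySeq hF hf ih)
      rwa [hc, Subgroup.mem_bot] at this
  | succ r ih =>
    intro f hf hK j hj1 hj h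
    by_cases hjc : c < j
    · obtain ⟨l, hl, h'⟩ := ih hf hK hj1 (by omega) h
      exact ⟨l, by omega, h'⟩
    have hfj := apply_mem_of_mem_polySeq hF hf h
    -- Removing the Taylor term of degree `j` makes the value at `j` trivial and leaves the earlier
    -- ones trivial.
    obtain ⟨l, hl, hlK, hprod⟩ := ih (f := (fun n => f j ^ n.choose j)⁻¹ * f) (j := j + 1)
      (mul_mem (inv_mem (pow_choose_mem_polySeq hF hfj)) hf)
      (fun m => mul_mem (inv_mem (pow_mem (hK j) _)) (hK m)) (by omega) (by omega)
      (fun m hm => by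
        rcases Nat.lt_succ_iff_lt_or_eq.1 hm with hm | rfl
        · simp [h m hm, Nat.choose_eq_zero_of_lt hm]
        · simp)
    obtain ⟨b, hb⟩ := hQ j hj1 (by omega)
    refine ⟨f j ^ b :: l, by simpa using hl, ?_, ?_⟩
    · simpa using ⟨pow_mem (hK j) _, hlK⟩
    · rw [List.map_cons, List.prod_cons, ← hprod, ← pow_mul, mul_comm b, ← hb]
      simp

end PolynomialSequences

/-! ### Products of powers in nilpotent groups -/

section Powers

/-- From `i * n.choose i = n * (n - 1).choose (i - 1)` and `i ∣ c!`. -/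
theorem mul_dvd_choose_of_factorial_mul_dvd {c i n Q : ℕ} (hi : 1 ≤ i) (hic : i ≤ c)
    (h : c.factorial * Q ∣ n) : Q ∣ n.choose i := by
  obtain ⟨s, rfl⟩ := h
  obtain ⟨t, ht⟩ := Nat.dvd_factorial hi hic
  obtain ⟨i, rfl⟩ : ∃ i', i = i' + 1 := ⟨i - 1, by omega⟩
  rcases Nat.eq_zero_or_pos (c.factorial * Q * s) with h0 | h0
  · rw [h0]; simp
  obtain ⟨m, hm⟩ : ∃ m, c.factorial * Q * s = m + 1 := ⟨_, (Nat.succ_pred_eq_of_pos h0).symm⟩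
  have := Nat.add_one_mul_choose_eq m i
  rw [hm]
  refine ⟨t * s * m.choose i, ?_⟩
  apply Nat.eq_of_mul_eq_mul_right (Nat.succ_pos i)
  rw [Nat.succ_eq_add_one, ← this, ← hm, ht]
  ring

/-- The Hall–Petrescu expansion of a product of powers, evaluated at a highly divisible exponent. -/
theorem exists_prod_pow_eq {G : Type*} [Group G] {c : ℕ}
    (hc : (⊤ : Subgroup G).lowerCentralSeries c = ⊥) (K : Subgroup G) [K.Normal] (l : List G)
    (hl : ∀ n : ℕ, l.prod⁻¹ ^ n * (l.map (· ^ n)).prod ∈ K) {n Q : ℕ}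
    (hn : c.factorial * Q ∣ n) :
    ∃ l' : List G, l'.length ≤ c ∧ (∀ a ∈ l', a ∈ K) ∧
      (l.map (· ^ n)).prod = l.prod ^ n * (l'.map (· ^ Q)).prod := by
  have hF := isGroupFiltration_lowerCentralSeries G
  have hpow : ∀ a : G, (fun n : ℕ => a ^ n) ∈ polySeq hF 0 := fun a => by
    simpa using pow_choose_mem_polySeq hF (j := 1) (k := 0) (a := a) (by simp)
  have hprod : ∀ l : List G, (fun n : ℕ => (l.map (· ^ n)).prod) ∈ polySeq hF 0 := by
    intro l
    induction l with
    | nil => exact one_mem _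
    | cons a l ih => exact mul_mem (hpow a) ih
  obtain ⟨l', hl', hK, h⟩ := exists_prod_pow_eq_of_mem_polySeq hF (c := c) (by simpa using hc) K
    (n := n) (Q := Q) (fun i h1 h2 => mul_dvd_choose_of_factorial_mul_dvd h1 h2 hn) c
    (mul_mem (hpow l.prod⁻¹) (hprod l)) hl (j := 2) (by omega) (by omega)
    -- The quotient of the two sides is trivial at `0` and `1`, so its expansion starts in degree
    -- `2`.
    (fun m hm => by interval_cases m <;> simp)
  refine ⟨l', hl', hK, ?_⟩
  rw [← h]
  simp

/-- The factors are absorbed one at a time; each absorption divides the available exponent by `k`.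
-/
theorem exists_pow_mul_prod_pow_eq {G : Type*} [Group G] {i k : ℕ}
    (h : ∀ (M : ℕ) (x u : G), u ∈ (⊤ : Subgroup G).lowerCentralSeries i →
      ∃ y, x ^ (k * M) * u ^ (k * M) = y ^ M) (r : ℕ) :
    ∀ (l : List G), l.length ≤ r → (∀ a ∈ l, a ∈ (⊤ : Subgroup G).lowerCentralSeries i) →
      ∀ (M P Q : ℕ) (x : G), k ^ r * M ∣ P → k ^ r * M ∣ Q →
        ∃ y, x ^ P * (l.map (· ^ Q)).prod = y ^ M := by
  induction r with
  | zero =>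
    intro l hl _ M P Q x ⟨s, hs⟩ _
    obtain rfl : l = [] := List.length_eq_zero_iff.1 (by omega)
    exact ⟨x ^ s, by rw [← pow_mul]; simp [hs, mul_comm]⟩
  | succ r ih =>
    intro l hl hmem M P Q x ⟨s, hs⟩ ⟨t, ht⟩
    cases l with
    | nil => exact ⟨x ^ (k ^ (r + 1) * s), by rw [← pow_mul, hs]; simp; congr 1; ring⟩
    | cons a l =>
      obtain ⟨y, hy⟩ := h (k ^ r * M) (x ^ s) (a ^ t) (pow_mem (hmem a (by simp)) _)
      obtain ⟨z, hz⟩ := ih l (by simpa using hl) (fun b hb => hmem b (by simp [hb])) M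
        (k ^ r * M) Q y dvd_rfl ⟨k * t, by rw [ht]; ring⟩
      refine ⟨z, ?_⟩
      rw [← hz, ← hy, List.map_cons, List.prod_cons, ← mul_assoc, ← pow_mul, ← pow_mul, hs, ht]
      congr 3 <;> ring

/-- In a nilpotent group of class at most `c`, the product of a `k M`-th power and the `k M`-th
power of an element of a term of the lower central series is an `M`-th power. -/
theorem exists_pow_mul_pow_eq_pow (c i : ℕ) : ∃ k : ℕ, 0 < k ∧ ∀ (G : Type*) [Group G],
    (⊤ : Subgroup G).lowerCentralSeries c = ⊥ → ∀ (M : ℕ) (x u : G),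
      u ∈ (⊤ : Subgroup G).lowerCentralSeries i → ∃ y, x ^ (k * M) * u ^ (k * M) = y ^ M := by
  obtain hi | hi := le_total c i
  · refine ⟨1, one_pos, fun G _ hc M x u hu => ⟨x, ?_⟩⟩
    have := Subgroup.lowerCentralSeries_antitone _ hi hu
    rw [hc, Subgroup.mem_bot] at this
    simp [this]
  induction hi using Nat.decreasingInduction with
  | self =>
    refine ⟨1, one_pos, fun G _ hc M x u hu => ⟨x, ?_⟩⟩
    rw [hc, Subgroup.mem_bot] at hu
    simp [hu]
  | of_succ i hi ih =>
    obtain ⟨k, hk, h⟩ := ih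
    -- The factorial clears the denominators of the binomial coefficients; `k ^ c` pays for
    -- absorbing at most `c` correction factors. These lie in `lcs (i + 1)`, because `u` is central
    -- modulo it, so the induction hypothesis applies to them.
    refine ⟨c.factorial * k ^ c, by positivity, fun G _ hc M x u hu => ?_⟩
    have hcomm : ∀ g : G, (QuotientGroup.mk u : G ⧸ (⊤ : Subgroup G).lowerCentralSeries (i + 1)) *
        QuotientGroup.mk g = QuotientGroup.mk g * QuotientGroup.mk u := by
      intro g
      rw [← commutatorElement_eq_one_iff_mul_comm]
      refine (QuotientGroup.eq_one_iff ⁅u, g⁆).2 ?_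
      rw [Subgroup.lowerCentralSeries_succ]
      exact Subgroup.commutator_mem_commutator hu trivial
    obtain ⟨l, hl, hmem, hprod⟩ := exists_prod_pow_eq hc
      ((⊤ : Subgroup G).lowerCentralSeries (i + 1)) [x, u] (fun n => by
        rw [← QuotientGroup.eq_one_iff]
        have hc' : Commute (QuotientGroup.mk x : G ⧸ (⊤ : Subgroup G).lowerCentralSeries (i + 1))
          (QuotientGroup.mk u) := (hcomm x).symm
        simp [-mul_inv_rev, -Subgroup.lowerCentralSeries_succ, hc'.mul_pow])
      (n := c.factorial * k ^ c * M) (Q := k ^ c * M) (by rw [mul_assoc])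
    simp only [List.map_cons, List.map_nil, List.prod_cons, List.prod_nil, mul_one] at hprod
    rw [hprod]
    exact exists_pow_mul_prod_pow_eq (h G hc) c l hl hmem M _ _ (x * u)
      (by rw [mul_assoc]; exact Dvd.intro_left _ rfl) dvd_rfl

/-- In nilpotent groups of class at most `c`, products of `k M`-th powers are `M`-th powers. -/
theorem exists_eq_pow_of_mem_closure_pow (c : ℕ) : ∃ k : ℕ, 0 < k ∧ ∀ (G : Type*) [Group G],
    (⊤ : Subgroup G).lowerCentralSeries c = ⊥ → ∀ (M : ℕ),
      ∀ g ∈ Subgroup.closure (Set.range fun x : G => x ^ (k * M)), ∃ y, g = y ^ M := by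
  obtain ⟨k, hk, h⟩ := exists_pow_mul_pow_eq_pow c 1
  refine ⟨c.factorial * k ^ c, by positivity, fun G _ hc M g hg => ?_⟩
  obtain ⟨l, hl⟩ : ∃ l : List G, g = (l.map (· ^ (c.factorial * k ^ c * M))).prod := by
    induction hg using Subgroup.closure_induction with
    | mem x hx => obtain ⟨y, rfl⟩ := hx; exact ⟨[y], by simp⟩
    | one => exact ⟨[], rfl⟩
    | mul x y _ _ hx hy =>
      obtain ⟨l, rfl⟩ := hx
      obtain ⟨l', rfl⟩ := hy
      exact ⟨l ++ l', by simp⟩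
    | inv x _ hx =>
      obtain ⟨l, rfl⟩ := hx
      refine ⟨(l.map (·⁻¹)).reverse, ?_⟩
      rw [List.prod_inv_reverse, List.map_reverse, List.map_map, List.map_map]
      congr 3
      funext x
      simp
  obtain ⟨l', hl', hmem, hprod⟩ := exists_prod_pow_eq hc
    ((⊤ : Subgroup G).lowerCentralSeries 1) l (fun n => by
      have key : ∀ f : G →* Abelianization G, ∀ l : List G,
          f (l.prod⁻¹ ^ n * (l.map (· ^ n)).prod) = 1 := by
        intro f l
        induction l with
        | nil => simp
        | cons a l ih =>
          simp only [map_mul, map_pow, map_inv, List.prod_cons, List.map_cons, mul_pow,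
            mul_inv] at ih ⊢
          rw [mul_mul_mul_comm, ih]; simp
      have := key Abelianization.of l
      rw [← MonoidHom.mem_ker, Abelianization.ker_of] at this
      rwa [Subgroup.top_lowerCentralSeries_one])
    (n := c.factorial * k ^ c * M) (Q := k ^ c * M) (by rw [mul_assoc])
  rw [hl, hprod]
  obtain ⟨y, hy⟩ := exists_pow_mul_prod_pow_eq (h G hc) c l' hl' hmem M
    (c.factorial * k ^ c * M) _ l.prod
    (by rw [mul_assoc]; exact Dvd.intro_left _ rfl) dvd_rfl
  exact ⟨y, hy⟩

end Powers

/-! ### Cyclic series and bounded torsion -/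

section CyclicSeries

theorem mem_lowerCentralSeries_commutator {G : Type*} [Group G] {i j : ℕ} {x y : G}
    (hx : x ∈ (⊤ : Subgroup G).lowerCentralSeries i)
    (hy : y ∈ (⊤ : Subgroup G).lowerCentralSeries j) :
    ⁅x, y⁆ ∈ (⊤ : Subgroup G).lowerCentralSeries (i + j + 1) :=
  commutator_lowerCentralSeries_le i j (Subgroup.commutator_mem_commutator hx hy)

theorem normal_of_between_lowerCentralSeries {G : Type*} [Group G] {D : Subgroup G} {k : ℕ}
    (h1 : (⊤ : Subgroup G).lowerCentralSeries (k + 1) ≤ D)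
    (h2 : D ≤ (⊤ : Subgroup G).lowerCentralSeries k) : D.Normal := by
  rw [← Subgroup.commutator_top_right_le_iff]
  exact (Subgroup.commutator_mono h2 le_rfl).trans h1

/-- The terms of the lower central series of a finitely generated group are finitely generated
modulo the next one. -/
theorem exists_finset_lowerCentralSeries_le {G : Type*} [Group G] (X : Finset G)
    (hX : Subgroup.closure (X : Set G) = ⊤) (k : ℕ) :
    ∃ T : Finset G, (∀ a ∈ T, a ∈ (⊤ : Subgroup G).lowerCentralSeries k) ∧
      (⊤ : Subgroup G).lowerCentralSeries k ≤
        Subgroup.closure (T : Set G) ⊔ (⊤ : Subgroup G).lowerCentralSeries (k + 1) := by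
  classical
  induction k with
  | zero => exact ⟨X, fun _ _ => trivial, by simp [hX]⟩
  | succ k ih =>
    obtain ⟨T, hT, hle⟩ := ih
    refine ⟨Finset.image₂ (fun a x => ⁅a, x⁆) T X, ?_, ?_⟩
    · intro b hb
      obtain ⟨a, ha, x, -, rfl⟩ := Finset.mem_image₂.1 hb
      exact mem_lowerCentralSeries_commutator (j := 0) (hT a ha) trivial
    set U : Finset G := Finset.image₂ (fun a x => ⁅a, x⁆) T X
    set D := Subgroup.closure (U : Set G) ⊔ (⊤ : Subgroup G).lowerCentralSeries (k + 1 + 1)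
    have hD : D.Normal := by
      refine normal_of_between_lowerCentralSeries (k := k + 1) le_sup_right (sup_le ?_ ?_)
      · rw [Subgroup.closure_le]
        intro b hb
        obtain ⟨a, ha, x, -, rfl⟩ := Finset.mem_image₂.1 hb
        exact mem_lowerCentralSeries_commutator (j := 0) (hT a ha) trivial
      · exact Subgroup.lowerCentralSeries_antitone _ (Nat.le_succ _)
    have hcomm : ∀ a b : G, ⁅a, b⁆ ∈ D ↔
        (QuotientGroup.mk' D a) * (QuotientGroup.mk' D b) =
          (QuotientGroup.mk' D b) * (QuotientGroup.mk' D a) := fun a b => by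
      rw [← commutatorElement_eq_one_iff_mul_comm, ← map_commutatorElement]
      exact (QuotientGroup.eq_one_iff _).symm
    -- It suffices that `lcs k` is central modulo `D`. For elements of `T` this need only be tested
    -- against `X`; elements of `lcs (k + 1)` have their commutators in `lcs (k + 2)`.
    have hC : (⊤ : Subgroup G).lowerCentralSeries k ≤
        (Subgroup.center (G ⧸ D)).comap (QuotientGroup.mk' D) := by
      refine hle.trans (sup_le ?_ ?_)
      · rw [Subgroup.closure_le]
        intro a ha
        have h : Subgroup.closure (X : Set G) ≤
            (Subgroup.centralizer {QuotientGroup.mk' D a}).comap (QuotientGroup.mk' D) := by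
          rw [Subgroup.closure_le]
          intro x hx
          refine Subgroup.mem_comap.2 (Subgroup.mem_centralizer_singleton_iff.2 ?_)
          refine ((hcomm a x).1 (Subgroup.mem_sup_left (Subgroup.subset_closure ?_))).symm
          exact Finset.mem_image₂.2 ⟨a, ha, x, hx, rfl⟩
        refine Subgroup.mem_comap.2 (Subgroup.mem_center_iff.2 fun q => ?_)
        obtain ⟨g, rfl⟩ := QuotientGroup.mk'_surjective D q
        exact Subgroup.mem_centralizer_singleton_iff.1 (h (hX ▸ Subgroup.mem_top g))
      · intro a ha
        refine Subgroup.mem_comap.2 (Subgroup.mem_center_iff.2 fun q => ?_)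
        obtain ⟨g, rfl⟩ := QuotientGroup.mk'_surjective D q
        exact ((hcomm a g).1 (Subgroup.mem_sup_right
          (mem_lowerCentralSeries_commutator (j := 0) ha trivial))).symm
    rw [Subgroup.lowerCentralSeries_succ, Subgroup.commutator_le]
    intro a ha b _
    exact (hcomm a b).2 (Subgroup.mem_center_iff.1 (hC ha) _).symm

/-- `B` is normal and `A` is generated by `B` and one more element. -/
def IsCyclicStep {G : Type*} [Group G] (A B : Subgroup G) : Prop :=
  B.Normal ∧ ∃ x, A = Subgroup.zpowers x ⊔ B

theorem IsCyclicStep.isCyclic {G : Type*} [Group G] {A B : Subgroup G} (h : IsCyclicStep A B) :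
    ∃ _ : (B.subgroupOf A).Normal, IsCyclic (A ⧸ B.subgroupOf A) := by
  obtain ⟨hB, x, rfl⟩ := h
  refine ⟨inferInstance, ⟨QuotientGroup.mk ⟨x, Subgroup.mem_sup_left
    (Subgroup.mem_zpowers x)⟩, fun q => ?_⟩⟩
  obtain ⟨⟨a, ha⟩, rfl⟩ := QuotientGroup.mk_surjective q
  obtain ⟨y, hy, b, hb, rfl⟩ := Subgroup.mem_sup_of_normal_right.1 ha
  obtain ⟨z, rfl⟩ := Subgroup.mem_zpowers_iff.1 hy
  refine ⟨z, ?_⟩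
  simp only
  rw [← QuotientGroup.mk_zpow]
  refine QuotientGroup.eq.2 ?_
  rw [Subgroup.mem_subgroupOf]
  simpa using hb

theorem exists_seq_of_reflTransGen {α : Type*} {r : α → α → Prop} {a b : α}
    (h : Relation.ReflTransGen r a b) :
    ∃ (n : ℕ) (S : ℕ → α), S 0 = a ∧ S n = b ∧ ∀ i < n, r (S i) (S (i + 1)) := by
  induction h using Relation.ReflTransGen.head_induction_on with
  | refl => exact ⟨0, fun _ => b, rfl, rfl, by simp⟩
  | @head a' c' h _ ih =>
    obtain ⟨n, S, h0, hn, hr⟩ := ih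
    refine ⟨n + 1, fun i => Nat.casesOn i a' S, rfl, hn, fun i hi => ?_⟩
    cases i with
    | zero => simpa [h0] using h
    | succ i => exact hr i (by omega)

/-- A finitely generated nilpotent group has a subnormal series with cyclic factors. -/
theorem exists_isCyclicSeries {G : Type*} [Group G] [Group.IsNilpotent G] (X : Finset G)
    (hX : Subgroup.closure (X : Set G) = ⊤) :
    ∃ (n : ℕ) (S : ℕ → Subgroup G), IsCyclicSeries n S := by
  classical
  have hchain : ∀ k, Relation.ReflTransGen IsCyclicStep (⊤ : Subgroup G)
      ((⊤ : Subgroup G).lowerCentralSeries k) := by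
    intro k
    induction k with
    | zero => exact Relation.ReflTransGen.refl
    | succ k ih =>
      refine ih.trans ?_
      obtain ⟨T, hT, hle⟩ := exists_finset_lowerCentralSeries_le X hX k
      have hge : (⊤ : Subgroup G).lowerCentralSeries k =
          Subgroup.closure (T : Set G) ⊔ (⊤ : Subgroup G).lowerCentralSeries (k + 1) :=
        le_antisymm hle (sup_le ((Subgroup.closure_le _).2 hT)
          (Subgroup.lowerCentralSeries_antitone _ (Nat.le_succ k)))
      rw [hge]
      clear hle hge
      induction T using Finset.induction_on with
      | empty => simpa using Relation.ReflTransGen.refl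
      | insert a T _ ihT =>
        refine Relation.ReflTransGen.head ?_ (ihT fun b hb => hT b (Finset.mem_insert_of_mem hb))
        refine ⟨?_, a, ?_⟩
        · refine normal_of_between_lowerCentralSeries (k := k) le_sup_right (sup_le ?_ ?_)
          · exact (Subgroup.closure_le _).2 fun b hb => hT b (Finset.mem_insert_of_mem hb)
          · exact Subgroup.lowerCentralSeries_antitone _ (Nat.le_succ _)
        · rw [Finset.coe_insert, Set.insert_eq, Subgroup.closure_union, sup_assoc,
            Subgroup.zpowers_eq_closure]
  obtain ⟨c, hc⟩ := (Subgroup.nilpotent_iff_lowerCentralSeries (G := G)).1 inferInstance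
  obtain ⟨n, S, h0, hn, hS⟩ := exists_seq_of_reflTransGen (hc ▸ hchain c)
  refine ⟨n, S, h0, hn, fun i hi => ?_, fun i hi => (hS i hi).isCyclic⟩
  obtain ⟨-, x, hx⟩ := hS i hi
  rw [hx]
  exact le_sup_right

/-- Descend the series: a torsion element vanishes in an infinite cyclic factor, and in a finite
factor after raising to the order of the factor. -/
theorem exists_pow_eq_one_of_isOfFinOrder {G : Type*} [Group G] {n : ℕ} {S : ℕ → Subgroup G}
    (hS : IsCyclicSeries n S) : ∃ e : ℕ, 0 < e ∧ ∀ y : G, IsOfFinOrder y → y ^ e = 1 := by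
  suffices ∀ j ≤ n, ∃ e : ℕ, 0 < e ∧ ∀ y : G, IsOfFinOrder y → y ^ e ∈ S j by
    obtain ⟨e, he, h⟩ := this n le_rfl
    exact ⟨e, he, fun y hy => by simpa [hS.last_eq] using h y hy⟩
  intro j
  induction j with
  | zero => exact fun _ => ⟨1, one_pos, fun y _ => by simp [hS.zero_eq]⟩
  | succ j ih =>
    intro hj
    obtain ⟨e, he, h⟩ := ih (by omega)
    obtain ⟨_, hcyc⟩ := hS.cyclic j (by omega)
    set Q := S j ⧸ (S (j + 1)).subgroupOf (S j)
    have key : ∃ t : ℕ, 0 < t ∧ ∀ q : Q, IsOfFinOrder q → q ^ t = 1 := by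
      cases finite_or_infinite Q with
      | inl hf => exact ⟨Nat.card Q, Nat.card_pos, fun q _ => pow_card_eq_one'⟩
      | inr hi =>
        refine ⟨1, one_pos, fun q hq => ?_⟩
        obtain ⟨g, hg⟩ := hcyc.exists_generator
        obtain ⟨z, rfl⟩ := Subgroup.mem_zpowers_iff.1 (hg q)
        obtain ⟨M, hM, hqM⟩ := isOfFinOrder_iff_pow_eq_one.1 hq
        have h0 := Infinite.orderOf_eq_zero_of_forall_mem_zpowers hg
        rw [← zpow_natCast, ← zpow_mul, ← orderOf_dvd_iff_zpow_eq_one, h0, Nat.cast_zero,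
          zero_dvd_iff, mul_eq_zero] at hqM
        rcases hqM with rfl | hqM
        · simp
        · omega
    obtain ⟨t, ht, hQ⟩ := key
    refine ⟨e * t, by positivity, fun y hy => ?_⟩
    have := hQ (QuotientGroup.mk ⟨y ^ e, h y hy⟩) (by
      obtain ⟨M, hM, hyM⟩ := isOfFinOrder_iff_pow_eq_one.1 hy
      refine isOfFinOrder_iff_pow_eq_one.2 ⟨M, hM, ?_⟩
      rw [← QuotientGroup.mk_pow]
      refine (QuotientGroup.eq_one_iff _).2 ?_
      rw [Subgroup.mem_subgroupOf]
      have : (y ^ e) ^ M = 1 := by rw [← pow_mul, mul_comm, pow_mul, hyM, one_pow]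
      simp [this])
    rw [← QuotientGroup.mk_pow] at this
    have := (QuotientGroup.eq_one_iff _).1 this
    rw [Subgroup.mem_subgroupOf] at this
    simpa [pow_mul] using this

end CyclicSeries

/-! ### Words with weighted letters -/

section WordCost

/-- The elements that are products of letters from `T` and their inverses of total cost at most
`R`, where a letter `(x, w)` of weight `w` costs `v w`. -/
def wordCost {G : Type*} [Group G] (T : Set (G × ℕ)) (v : ℕ → ℕ) (R : ℕ) : Set G :=
  {g | ∃ l : List (G × ℕ), (∀ p ∈ l, p ∈ T ∨ (p.1⁻¹, p.2) ∈ T) ∧ (l.map Prod.fst).prod = g ∧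
    (l.map fun p => v p.2).sum ≤ R}

variable {G : Type*} [Group G] {T T' : Set (G × ℕ)} {v : ℕ → ℕ} {R R' : ℕ} {g h : G}

theorem wordCost_mono (hT : T ⊆ T') (hR : R ≤ R') (hg : g ∈ wordCost T v R) :
    g ∈ wordCost T' v R' := by
  obtain ⟨l, hl, hp, hs⟩ := hg
  exact ⟨l, fun p hp => (hl p hp).imp (@hT _) (@hT _), hp, hs.trans hR⟩

theorem one_mem_wordCost : (1 : G) ∈ wordCost T v R := ⟨[], by simp, rfl, by simp⟩

theorem mul_mem_wordCost (hg : g ∈ wordCost T v R) (hh : h ∈ wordCost T v R') :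
    g * h ∈ wordCost T v (R + R') := by
  obtain ⟨l, hl, rfl, hs⟩ := hg
  obtain ⟨l', hl', rfl, hs'⟩ := hh
  refine ⟨l ++ l', fun p hp => ?_, by simp, by simpa using add_le_add hs hs'⟩
  rcases List.mem_append.1 hp with hp | hp
  exacts [hl p hp, hl' p hp]

theorem inv_mem_wordCost (hg : g ∈ wordCost T v R) : g⁻¹ ∈ wordCost T v R := by
  obtain ⟨l, hl, rfl, hs⟩ := hg
  refine ⟨(l.map fun p => (p.1⁻¹, p.2)).reverse, fun p hp => ?_, ?_, ?_⟩
  · obtain ⟨q, hq, rfl⟩ := List.mem_map.1 (List.mem_reverse.1 hp)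
    simpa using (hl q hq).symm
  · rw [List.prod_inv_reverse, List.map_reverse, List.map_map, List.map_map]
    rfl
  · rw [List.map_reverse, List.sum_reverse, List.map_map]
    exact hs

theorem mem_wordCost_of_letter {p : G × ℕ} (hp : p ∈ T ∨ (p.1⁻¹, p.2) ∈ T) :
    p.1 ∈ wordCost T v (v p.2) := ⟨[p], by simpa using hp, by simp, by simp⟩

theorem pow_mem_wordCost (hg : g ∈ wordCost T v R) (k : ℕ) : g ^ k ∈ wordCost T v (k * R) := by
  induction k with
  | zero => simpa using one_mem_wordCost
  | succ k ih =>
    rw [pow_succ, add_mul, one_mul]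
    exact mul_mem_wordCost ih hg

theorem zpow_mem_wordCost (hg : g ∈ wordCost T v R) (z : ℤ) :
    g ^ z ∈ wordCost T v (z.natAbs * R) := by
  obtain ⟨k, rfl | rfl⟩ := z.eq_nat_or_neg
  · simpa using pow_mem_wordCost hg k
  · simpa using inv_mem_wordCost (pow_mem_wordCost hg k)

theorem exists_mem_wordCost_of_mem_closure (hg : g ∈ Subgroup.closure (Prod.fst '' T)) :
    ∃ R, g ∈ wordCost T (fun _ => 1) R := by
  induction hg using Subgroup.closure_induction with
  | mem x hx =>
    obtain ⟨p, hp, rfl⟩ := hx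
    exact ⟨1, mem_wordCost_of_letter (v := fun _ => 1) (Or.inl hp)⟩
  | one => exact ⟨0, one_mem_wordCost⟩
  | mul x y _ _ hx hy =>
    obtain ⟨R, hR⟩ := hx
    obtain ⟨R', hR'⟩ := hy
    exact ⟨_, mul_mem_wordCost hR hR'⟩
  | inv x _ hx =>
    obtain ⟨R, hR⟩ := hx
    exact ⟨R, inv_mem_wordCost hR⟩

/-- Substitution of words for letters. -/
theorem map_mem_wordCost {v' : ℕ → ℕ} (φ : G →* G) {K : ℕ}
    (h : ∀ p : G × ℕ, (p ∈ T ∨ (p.1⁻¹, p.2) ∈ T) → φ p.1 ∈ wordCost T' v' (K * v p.2))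
    (hg : g ∈ wordCost T v R) : φ g ∈ wordCost T' v' (K * R) := by
  obtain ⟨l, hl, rfl, hs⟩ := hg
  refine wordCost_mono subset_rfl (Nat.mul_le_mul_left K hs) ?_
  clear hs
  induction l with
  | nil => simpa using one_mem_wordCost
  | cons p l ih =>
    simp only [List.map_cons, List.prod_cons, List.sum_cons, map_mul, mul_add]
    exact mul_mem_wordCost (h p (hl p (by simp))) (ih fun q hq => hl q (by simp [hq]))

/-- A homomorphism to `ℤ` is bounded linearly in terms of the cost. -/
theorem natAbs_le_of_mem_wordCost {L : Subgroup G} (f : L →* Multiplicative ℤ) {u B : ℕ}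
    (h : ∀ p ∈ T, ∃ hp : p.1 ∈ L, (f ⟨p.1, hp⟩).toAdd.natAbs * u ≤ B * v p.2)
    (hg : g ∈ wordCost T v R) : ∃ hg : g ∈ L, (f ⟨g, hg⟩).toAdd.natAbs * u ≤ B * R := by
  obtain ⟨l, hl, rfl, hs⟩ := hg
  suffices ∃ hg : (l.map Prod.fst).prod ∈ L, (f ⟨_, hg⟩).toAdd.natAbs * u ≤
      B * (l.map fun p => v p.2).sum by
    obtain ⟨hg, h'⟩ := this
    exact ⟨hg, h'.trans (Nat.mul_le_mul_left B hs)⟩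
  clear hs
  induction l with
  | nil => exact ⟨one_mem _, by simp [show (⟨1, one_mem L⟩ : L) = 1 from rfl]⟩
  | cons p l ih =>
    obtain ⟨hL, hle⟩ := ih fun q hq => hl q (by simp [hq])
    have hp : ∃ hp : p.1 ∈ L, (f ⟨p.1, hp⟩).toAdd.natAbs * u ≤ B * v p.2 := by
      rcases hl p (by simp) with hp | hp
      · exact h p hp
      · obtain ⟨h1, h2⟩ := h _ hp
        refine ⟨by simpa using h1, ?_⟩
        have e : (⟨p.1⁻¹, h1⟩ : L) = (⟨p.1, by simpa using h1⟩ : L)⁻¹ := rfl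
        rw [e, map_inv, toAdd_inv, Int.natAbs_neg] at h2
        exact h2
    obtain ⟨hpL, hple⟩ := hp
    simp only [List.map_cons, List.prod_cons, List.sum_cons]
    refine ⟨mul_mem hpL hL, ?_⟩
    have e : (⟨p.1 * (l.map Prod.fst).prod, mul_mem hpL hL⟩ : L) = ⟨_, hpL⟩ * ⟨_, hL⟩ := rfl
    rw [e, map_mul, toAdd_mul, mul_add]
    refine (Nat.mul_le_mul_right u (Int.natAbs_add_le _ _)).trans ?_
    rw [add_mul]
    exact add_le_add hple hle

end WordCost

/-! ### Conjugation and the cost of words -/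

section Distortion

theorem Set.Finite.exists_nat_forall {α : Type*} {F : Set α} (hF : F.Finite)
    {P : α → ℕ → Prop} (hmono : ∀ a, ∀ m n, m ≤ n → P a m → P a n) (h : ∀ a ∈ F, ∃ m, P a m) :
    ∃ m, ∀ a ∈ F, P a m := by
  induction F, hF using Set.Finite.induction_on with
  | empty => exact ⟨0, by simp⟩
  | @insert a F _ _ ih =>
    obtain ⟨m, hm⟩ := ih fun b hb => h b (Set.mem_insert_of_mem _ hb)
    obtain ⟨n, hn⟩ := h a (Set.mem_insert _ _)
    refine ⟨max m n, fun b hb => ?_⟩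
    rcases hb with rfl | hb
    exacts [hmono _ _ _ (le_max_right _ _) hn, hmono _ _ _ (le_max_left _ _) (hm b hb)]

/-- A finite set of weighted letters such that each term `lcs k` of the lower central series is
generated by the letters of weight at least `k`. -/
structure IsWeightedGenerating {G : Type*} [Group G] (c : ℕ) (S : Set (G × ℕ)) : Prop where
  finite : S.Finite
  lt : ∀ p ∈ S, p.2 < c
  mem : ∀ p ∈ S, p.1 ∈ (⊤ : Subgroup G).lowerCentralSeries p.2
  gen : ∀ k, (⊤ : Subgroup G).lowerCentralSeries k ≤
    Subgroup.closure (Prod.fst '' {p ∈ S | k ≤ p.2})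

theorem exists_isWeightedGenerating {G : Type*} [Group G] (X : Finset G)
    (hX : Subgroup.closure (X : Set G) = ⊤) {c : ℕ}
    (hc : (⊤ : Subgroup G).lowerCentralSeries c = ⊥) :
    ∃ S : Set (G × ℕ), IsWeightedGenerating c S := by
  choose T hT hle using exists_finset_lowerCentralSeries_le X hX
  refine ⟨⋃ k ∈ Set.Iio c, (fun g => (g, k)) '' (T k : Set G), ?_, ?_, ?_, ?_⟩
  · exact (Set.finite_Iio c).biUnion fun k _ => (T k).finite_toSet.image _
  · intro p hp
    simp only [Set.mem_iUnion] at hp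
    obtain ⟨k, hk, g, hg, rfl⟩ := hp
    exact hk
  · intro p hp
    simp only [Set.mem_iUnion] at hp
    obtain ⟨k, hk, g, hg, rfl⟩ := hp
    exact hT k g hg
  · intro k
    obtain hk | hk := le_total c k
    · have := Subgroup.lowerCentralSeries_antitone (⊤ : Subgroup G) hk
      rw [hc] at this
      exact this.trans bot_le
    induction hk using Nat.decreasingInduction with
    | self => rw [hc]; exact bot_le
    | of_succ k hk ih =>
      refine (hle k).trans (sup_le (Subgroup.closure_mono ?_) (ih.trans
        (Subgroup.closure_mono (Set.image_mono fun p hp => ⟨hp.1, (Nat.le_succ k).trans hp.2⟩))))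
      intro g hg
      refine ⟨(g, k), ⟨?_, le_rfl⟩, rfl⟩
      simp only [Set.mem_iUnion]
      exact ⟨k, hk, g, hg, rfl⟩

variable {G : Type*} [Group G] {c : ℕ} {S : Set (G × ℕ)}

theorem IsWeightedGenerating.lowerCentralSeries_eq_bot (hS : IsWeightedGenerating c S) :
    (⊤ : Subgroup G).lowerCentralSeries c = ⊥ := by
  refine le_bot_iff.1 ((hS.gen c).trans ?_)
  rw [Subgroup.closure_le]
  rintro _ ⟨p, ⟨hp, hcp⟩, rfl⟩
  exact absurd (hS.lt p hp) (not_lt.2 hcp)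

/-- The cost `n ^ (c - 1 - w)` is chosen so that a budget `O(n ^ c)` allows `O(n ^ (w + 1))` letters
of weight `w`, the expected size of coordinates in `lcs w`. A fixed word has bounded length, and its
lightest letters are the dearest. -/
theorem exists_mem_wordCost_of_le_weight {T : Set (G × ℕ)} {a : ℕ} (hT : ∀ p ∈ T, a ≤ p.2) {g : G}
    (hg : g ∈ Subgroup.closure (Prod.fst '' T)) (c : ℕ) :
    ∃ R, ∀ n, 0 < n → g ∈ wordCost T (fun w => n ^ (c - 1 - w)) (R * n ^ (c - 1 - a)) := by
  obtain ⟨R, hR⟩ := exists_mem_wordCost_of_mem_closure hg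
  refine ⟨R, fun n hn => ?_⟩
  rw [mul_comm]
  refine map_mem_wordCost (MonoidHom.id G) (fun p hp => ?_) hR
  have hap : a ≤ p.2 := hp.elim (hT p) (hT (p.1⁻¹, p.2))
  refine wordCost_mono subset_rfl ?_ (mem_wordCost_of_letter hp)
  rw [mul_one]
  exact Nat.pow_le_pow_right hn (by omega)

/-- Conjugating a letter by a power of an element of weight `a` with exponent `O(n ^ (a + 1))`
multiplies its cost by a bounded factor. -/
theorem IsWeightedGenerating.conj_mem_wordCost (hS : IsWeightedGenerating c S) {x : G} {a : ℕ}
    (hx : x ∈ (⊤ : Subgroup G).lowerCentralSeries a) {T : Set (G × ℕ)} (hTS : T ⊆ S)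
    (hT : ∀ p ∈ S, a < p.2 → p ∈ T) (K : ℕ) :
    ∃ K', ∀ n, 0 < n → ∀ p : G × ℕ, (p ∈ T ∨ (p.1⁻¹, p.2) ∈ T) → ∀ s ≤ K * n ^ (a + 1),
      x⁻¹ ^ s * p.1 * x ^ s ∈ wordCost T (fun w => n ^ (c - 1 - w)) (K' * n ^ (c - 1 - p.2)) := by
  suffices ∀ b ≤ c, ∃ K', ∀ n, 0 < n → ∀ p : G × ℕ, (p ∈ T ∨ (p.1⁻¹, p.2) ∈ T) → b ≤ p.2 →
      ∀ s ≤ K * n ^ (a + 1), x⁻¹ ^ s * p.1 * x ^ s ∈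
        wordCost T (fun w => n ^ (c - 1 - w)) (K' * n ^ (c - 1 - p.2)) by
    obtain ⟨K', h⟩ := this 0 (Nat.zero_le c)
    exact ⟨K', fun n hn p hp => h n hn p hp (Nat.zero_le _)⟩
  have hlt : ∀ p : G × ℕ, (p ∈ T ∨ (p.1⁻¹, p.2) ∈ T) → p.2 < c := fun p hp =>
    hp.elim (fun h => hS.lt p (hTS h)) (fun h => hS.lt (p.1⁻¹, p.2) (hTS h))
  have hmem : ∀ p : G × ℕ, (p ∈ T ∨ (p.1⁻¹, p.2) ∈ T) →
      p.1 ∈ (⊤ : Subgroup G).lowerCentralSeries p.2 := fun p hp =>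
    hp.elim (fun h => hS.mem p (hTS h)) (fun h => by simpa using hS.mem (p.1⁻¹, p.2) (hTS h))
  intro b hb
  induction hb using Nat.decreasingInduction with
  | self => exact ⟨0, fun n _ p hp hcp => absurd (hlt p hp) (not_lt.2 hcp)⟩
  | of_succ b hb ih =>
    obtain ⟨K₁, h₁⟩ := ih
    have hfin : {p : G × ℕ | p ∈ T ∨ (p.1⁻¹, p.2) ∈ T}.Finite := by
      refine (hS.finite.subset hTS).union ?_
      refine (hS.finite.subset hTS).preimage (f := fun p : G × ℕ => (p.1⁻¹, p.2)) ?_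
      intro p _ q _ hpq
      simpa [Prod.ext_iff] using hpq
    obtain ⟨R, hR⟩ := hfin.exists_nat_forall
      (P := fun p R => p.2 = b → ∀ n, 0 < n → ⁅p.1⁻¹, x⁻¹⁆ ∈ wordCost
        {q ∈ S | b + a + 1 ≤ q.2} (fun w => n ^ (c - 1 - w)) (R * n ^ (c - 1 - (b + a + 1))))
      (fun p m m' hm h hp n hn => wordCost_mono subset_rfl (Nat.mul_le_mul_right _ hm) (h hp n hn))
      (fun p hp => by
        by_cases hpb : p.2 = b
        · have := mem_lowerCentralSeries_commutator (inv_mem (hmem p hp)) (inv_mem hx)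
          rw [hpb] at this
          obtain ⟨R, h⟩ := exists_mem_wordCost_of_le_weight (fun q hq => hq.2) (hS.gen _ this) c
          exact ⟨R, fun _ => h⟩
        · exact ⟨0, fun h => absurd h hpb⟩)
    refine ⟨K₁ + 1 + K * (K₁ * R), fun n hn p hp hbp s hs => ?_⟩
    rcases Nat.lt_or_eq_of_le hbp with hbp | hbp
    · exact wordCost_mono subset_rfl (Nat.mul_le_mul_right _ (by omega)) (h₁ n hn p hp hbp s hs)
    have hp1 := mem_wordCost_of_letter (v := fun w => n ^ (c - 1 - w)) hp
    -- Here the commutator is trivial. This case is separate because the truncated exponent `c - 1 -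
    -- (b + a + 1)` would spoil the count below.
    by_cases hab : c ≤ b + a + 1
    · have h1 := mem_lowerCentralSeries_commutator (inv_mem (hmem p hp)) (inv_mem hx)
      have h2 := Subgroup.lowerCentralSeries_antitone _ (hbp ▸ hab) h1
      rw [hS.lowerCentralSeries_eq_bot, Subgroup.mem_bot,
        commutatorElement_eq_one_iff_commute] at h2
      have h3 : Commute x p.1 := by simpa using h2.symm
      have h4 : x⁻¹ ^ s * p.1 * x ^ s = p.1 := by
        rw [mul_assoc, ← (h3.pow_left s).eq, inv_pow, inv_mul_cancel_left]
      rw [h4]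
      refine wordCost_mono subset_rfl ?_ hp1
      exact Nat.le_mul_of_pos_left _ (by positivity)
    have key : ∀ s ≤ K * n ^ (a + 1), x⁻¹ ^ s * p.1 * x ^ s ∈
        wordCost T (fun w => n ^ (c - 1 - w))
          (n ^ (c - 1 - p.2) + s * (K₁ * (R * n ^ (c - 1 - (b + a + 1))))) := by
      intro s
      induction s with
      | zero => simpa using hp1
      | succ s ihs =>
        intro hs
        have ht := map_mem_wordCost (T' := T) (MulAut.conj (x⁻¹ ^ s)).toMonoidHom
          (v' := fun w => n ^ (c - 1 - w)) (K := K₁) (fun q hq => by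
            have hq' : q ∈ T ∨ (q.1⁻¹, q.2) ∈ T := hq.imp
              (fun h => hT _ h.1 (by have := h.2; omega))
              (fun h => hT _ h.1 (by have := h.2; dsimp only at this ⊢; omega))
            have hbq : b + 1 ≤ q.2 := hq.elim (fun h => by have := h.2; omega)
              (fun h => by have := h.2; dsimp only at this; omega)
            have := h₁ n hn q hq' hbq s (by omega)
            simpa only [MulEquiv.toMonoidHom_eq_coe, MonoidHom.coe_coe, MulAut.conj_apply, inv_pow,
              inv_inv] using this) (hR p hp hbp.symm n hn)
        -- Each further conjugation by `x` adds one conjugate of a fixed commutator of weight at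
        -- least `b + a + 1`. The saving `n ^ (a + 1)` in its cost offsets the number `s` of such
        -- factors.
        have e : x⁻¹ ^ (s + 1) * p.1 * x ^ (s + 1) = (x⁻¹ ^ s * p.1 * x ^ s) *
            (MulAut.conj (x⁻¹ ^ s)).toMonoidHom ⁅p.1⁻¹, x⁻¹⁆ := by
          simp only [MulEquiv.toMonoidHom_eq_coe, MonoidHom.coe_coe, MulAut.conj_apply,
            commutatorElement_def, inv_inv]
          rw [pow_succ, pow_succ']
          simp only [inv_pow, inv_inv]
          group
        rw [e, add_mul, one_mul, ← add_assoc]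
        exact mul_mem_wordCost (ihs (by omega)) ht
    refine wordCost_mono subset_rfl ?_ (key s hs)
    have e : n ^ (a + 1) * n ^ (c - 1 - (b + a + 1)) = n ^ (c - 1 - p.2) := by
      rw [← pow_add]; congr 1; omega
    calc n ^ (c - 1 - p.2) + s * (K₁ * (R * n ^ (c - 1 - (b + a + 1))))
        ≤ n ^ (c - 1 - p.2) + K * n ^ (a + 1) * (K₁ * (R * n ^ (c - 1 - (b + a + 1)))) := by gcongr
      _ = (1 + K * (K₁ * R)) * n ^ (c - 1 - p.2) := by rw [← e]; ring
      _ ≤ _ := by gcongr; omega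

end Distortion

/-! ### Eliminating letters of low weight -/

section Extraction

variable {G : Type*} [Group G] {c : ℕ} {S : Set (G × ℕ)}

/-- Collect the letters `x` on the left, conjugating the letters they pass. The budget itself bounds
the exponent, since each `x` costs `n ^ (c - 1 - a)`. -/
theorem exists_zpow_mul_mem_wordCost {x : G} {a n K K' : ℕ} (hn : 0 < n) (ha : a < c)
    {T : Set (G × ℕ)}
    (h : ∀ p : G × ℕ, (p ∈ T ∨ (p.1⁻¹, p.2) ∈ T) → ∀ z : ℤ, z.natAbs ≤ K * n ^ (a + 1) →
      x ^ (-z) * p.1 * x ^ z ∈ wordCost T (fun w => n ^ (c - 1 - w)) (K' * n ^ (c - 1 - p.2)))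
    {g : G} (hg : g ∈ wordCost (insert (x, a) T) (fun w => n ^ (c - 1 - w)) (K * n ^ c)) :
    ∃ (z : ℤ) (y : G), g = x ^ z * y ∧ z.natAbs ≤ K * n ^ (a + 1) ∧
      y ∈ wordCost T (fun w => n ^ (c - 1 - w)) (K' * (K * n ^ c)) := by
  obtain ⟨l, hl, rfl, hs⟩ := hg
  have hc : n ^ c = n ^ (a + 1) * n ^ (c - 1 - a) := by rw [← pow_add]; congr 1; omega
  have hpos : 0 < n ^ (c - 1 - a) := by positivity
  suffices ∃ (z : ℤ) (y : G), (l.map Prod.fst).prod = x ^ z * y ∧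
      z.natAbs * n ^ (c - 1 - a) ≤ (l.map fun p => n ^ (c - 1 - p.2)).sum ∧
      y ∈ wordCost T (fun w => n ^ (c - 1 - w))
        (K' * (l.map fun p => n ^ (c - 1 - p.2)).sum) by
    obtain ⟨z, y, h1, h2, h3⟩ := this
    refine ⟨z, y, h1, ?_, wordCost_mono subset_rfl (Nat.mul_le_mul_left _ hs) h3⟩
    have := h2.trans hs
    rw [hc, ← mul_assoc] at this
    exact Nat.le_of_mul_le_mul_right this hpos
  induction l with
  | nil => exact ⟨0, 1, by simp, by simp, one_mem_wordCost⟩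
  | cons p l ih =>
    simp only [List.map_cons, List.sum_cons, List.prod_cons] at hs ⊢
    obtain ⟨z, y, h1, h2, h3⟩ := ih (fun q hq => hl q (by simp [hq]))
      ((Nat.le_add_left _ _).trans hs)
    rw [h1]
    have hp : p = (x, a) ∨ p = (x⁻¹, a) ∨ (p ∈ T ∨ (p.1⁻¹, p.2) ∈ T) := by
      rcases hl p (by simp) with (h | h) | (h | h)
      · exact Or.inl h
      · exact Or.inr (Or.inr (Or.inl h))
      · refine Or.inr (Or.inl ?_)
        rw [Prod.ext_iff] at h ⊢
        exact ⟨by simpa [inv_eq_iff_eq_inv] using h.1, h.2⟩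
      · exact Or.inr (Or.inr (Or.inr h))
    rcases hp with rfl | rfl | hp
    · refine ⟨z + 1, y, by simp only; group, ?_,
        wordCost_mono subset_rfl (Nat.mul_le_mul_left _ (Nat.le_add_left _ _)) h3⟩
      calc (z + 1).natAbs * n ^ (c - 1 - a) ≤ (1 + z.natAbs) * n ^ (c - 1 - a) :=
            Nat.mul_le_mul_right _ (by omega)
        _ ≤ _ := by rw [add_mul, one_mul]; exact Nat.add_le_add_left h2 _
    · refine ⟨z - 1, y, by simp only; group, ?_,
        wordCost_mono subset_rfl (Nat.mul_le_mul_left _ (Nat.le_add_left _ _)) h3⟩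
      calc (z - 1).natAbs * n ^ (c - 1 - a) ≤ (1 + z.natAbs) * n ^ (c - 1 - a) :=
            Nat.mul_le_mul_right _ (by omega)
        _ ≤ _ := by rw [add_mul, one_mul]; exact Nat.add_le_add_left h2 _
    · have hz : z.natAbs ≤ K * n ^ (a + 1) := by
        have := h2.trans ((Nat.le_add_left _ _).trans hs)
        rw [hc, ← mul_assoc] at this
        exact Nat.le_of_mul_le_mul_right this hpos
      refine ⟨z, (x ^ (-z) * p.1 * x ^ z) * y, by group, h2.trans (Nat.le_add_left _ _), ?_⟩
      rw [mul_add]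
      exact mul_mem_wordCost (h p hp z hz) h3

/-- Elimination of a letter of weight `a` from the words for elements that can be written without
it: the total cost increases by a bounded factor only. -/
theorem IsWeightedGenerating.exists_mem_wordCost_of_insert (hS : IsWeightedGenerating c S) {x : G}
    {a : ℕ} (hxa : (x, a) ∈ S) {T : Set (G × ℕ)} (hTS : T ⊆ S) (hT : ∀ p ∈ S, a < p.2 → p ∈ T)
    (hT' : ∀ p ∈ T, a ≤ p.2) (K : ℕ) :
    ∃ K', ∀ n, 0 < n → ∀ g ∈ wordCost (insert (x, a) T) (fun w => n ^ (c - 1 - w)) (K * n ^ c),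
      g ∈ Subgroup.closure (Prod.fst '' T) →
        g ∈ wordCost T (fun w => n ^ (c - 1 - w)) (K' * n ^ c) := by
  have hx := hS.mem _ hxa
  have ha : a < c := hS.lt _ hxa
  obtain ⟨K₁, h₁⟩ := hS.conj_mem_wordCost hx hTS hT K
  obtain ⟨K₂, h₂⟩ := hS.conj_mem_wordCost (inv_mem hx) hTS hT K
  set C := Subgroup.closure (Prod.fst '' T)
  -- The exponents `z` with `x ^ z ∈ C` are the multiples of one `t`, so the collected power of `x`
  -- can be rewritten using a fixed word for `x ^ t`.
  obtain ⟨t, ht⟩ : ∃ t : ℤ, C.comap (zpowersHom G x) = Subgroup.zpowers (Multiplicative.ofAdd t) := by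
    obtain ⟨t, ht⟩ := (inferInstance : IsCyclic (C.comap (zpowersHom G x))).exists_generator
    refine ⟨t.1.toAdd, le_antisymm (fun s hs => ?_) ?_⟩
    · obtain ⟨k, hk⟩ := Subgroup.mem_zpowers_iff.1 (ht ⟨s, hs⟩)
      exact Subgroup.mem_zpowers_iff.2 ⟨k, congrArg Subtype.val hk⟩
    · rw [Subgroup.zpowers_le]
      exact t.2
  have hmem : ∀ z : ℤ, x ^ z ∈ C ↔ t ∣ z := fun z => by
    have h1 : x ^ z ∈ C ↔ Multiplicative.ofAdd z ∈ C.comap (zpowersHom G x) := by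
      rw [Subgroup.mem_comap]; rfl
    rw [h1, ht, Subgroup.mem_zpowers_iff]
    constructor
    · rintro ⟨k, hk⟩
      exact ⟨k, by rw [mul_comm]; exact (congrArg Multiplicative.toAdd hk).symm⟩
    · rintro ⟨k, rfl⟩
      exact ⟨k, by rw [← ofAdd_zsmul, smul_eq_mul, mul_comm]⟩
  obtain ⟨R, hR⟩ := exists_mem_wordCost_of_le_weight hT' ((hmem t).2 dvd_rfl) c
  refine ⟨K * R + (K₁ + K₂) * K, fun n hn g hg hgC => ?_⟩
  obtain ⟨z, y, rfl, hz, hy⟩ := exists_zpow_mul_mem_wordCost hn ha (K' := K₁ + K₂)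
    (fun p hp z hz => by
      obtain ⟨s, rfl | rfl⟩ := z.eq_nat_or_neg
      · refine wordCost_mono subset_rfl (Nat.mul_le_mul_right _ (Nat.le_add_right _ _)) ?_
        simpa using h₁ n hn p hp s (by simpa using hz)
      · refine wordCost_mono subset_rfl (Nat.mul_le_mul_right _ (Nat.le_add_left _ _)) ?_
        simpa using h₂ n hn p hp s (by simpa using hz)) hg
  have hyC : y ∈ C := by
    obtain ⟨l, hl, rfl, -⟩ := hy
    refine list_prod_mem fun q hq => ?_
    obtain ⟨p, hp, rfl⟩ := List.mem_map.1 hq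
    rcases hl p hp with h | h
    · exact Subgroup.subset_closure ⟨p, h, rfl⟩
    · exact inv_mem_iff.1 (Subgroup.subset_closure ⟨_, h, rfl⟩)
  obtain ⟨q, rfl⟩ := (hmem z).1 ((Subgroup.mul_mem_cancel_right _ hyC).1 hgC)
  rw [add_mul, mul_assoc (K₁ + K₂)]
  refine mul_mem_wordCost ?_ hy
  rcases eq_or_ne t 0 with rfl | ht0
  · simpa using one_mem_wordCost
  rw [zpow_mul]
  refine wordCost_mono subset_rfl ?_ (zpow_mem_wordCost (hR n hn) q)
  have hq : q.natAbs ≤ K * n ^ (a + 1) := by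
    refine le_trans ?_ hz
    rw [Int.natAbs_mul]
    exact Nat.le_mul_of_pos_left _ (Int.natAbs_pos.2 ht0)
  have hc : n ^ c = n ^ (a + 1) * n ^ (c - 1 - a) := by rw [← pow_add]; congr 1; omega
  calc q.natAbs * (R * n ^ (c - 1 - a)) ≤ K * n ^ (a + 1) * (R * n ^ (c - 1 - a)) := by gcongr
    _ = _ := by rw [hc]; ring

/-- Elements of the ball of radius `n` that lie in `lcs i` are words of total cost `O(n ^ c)` in the
letters of weight at least `i`. -/
theorem IsWeightedGenerating.exists_wordBall_subset (hS : IsWeightedGenerating c S) (X : Finset G)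
    (hc : 0 < c) (i : ℕ) :
    ∃ K, ∀ n, 0 < n → ∀ g ∈ wordBall X n, g ∈ (⊤ : Subgroup G).lowerCentralSeries i →
      g ∈ wordCost {p ∈ S | i ≤ p.2} (fun w => n ^ (c - 1 - w)) (K * n ^ c) := by
  classical
  induction i with
  | zero =>
    have hX : ∀ x : G, ∃ R, ∀ n, 0 < n → x ∈ wordCost {p ∈ S | 0 ≤ p.2}
        (fun w => n ^ (c - 1 - w)) (R * n ^ (c - 1)) := fun x =>
      exists_mem_wordCost_of_le_weight (fun _ _ => Nat.zero_le _) (hS.gen 0 trivial) c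
    obtain ⟨R, hR⟩ := X.finite_toSet.exists_nat_forall
      (P := fun x R => ∀ n, 0 < n → x ∈ wordCost {p ∈ S | 0 ≤ p.2}
        (fun w => n ^ (c - 1 - w)) (R * n ^ (c - 1)))
      (fun x m m' hm h n hn => wordCost_mono subset_rfl (Nat.mul_le_mul_right _ hm) (h n hn))
      (fun x _ => hX x)
    refine ⟨R, fun n hn g hg _ => ?_⟩
    obtain ⟨l, hl, hlX, rfl⟩ := hg
    have key : ∀ l : List G, (∀ x ∈ l, x ∈ X ∨ x⁻¹ ∈ X) → l.prod ∈ wordCost {p ∈ S | 0 ≤ p.2}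
        (fun w => n ^ (c - 1 - w)) (l.length * (R * n ^ (c - 1))) := by
      intro l hl
      induction l with
      | nil => exact one_mem_wordCost
      | cons x l ih =>
        rw [List.prod_cons, List.length_cons, add_mul, one_mul, add_comm]
        refine mul_mem_wordCost ?_ (ih fun y hy => hl y (by simp [hy]))
        rcases hl x (by simp) with h | h
        · exact hR x h n hn
        · simpa using inv_mem_wordCost (hR _ h n hn)
    refine wordCost_mono subset_rfl ?_ (key l hlX)
    obtain ⟨c, rfl⟩ : ∃ c', c = c' + 1 := ⟨c - 1, by omega⟩
    calc l.length * (R * n ^ (c + 1 - 1)) ≤ n * (R * n ^ (c + 1 - 1)) := by gcongr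
      _ = R * n ^ (c + 1) := by rw [Nat.add_sub_cancel]; ring
  | succ i ih =>
    obtain ⟨K, hK⟩ := ih
    have key : ∀ F : Set (G × ℕ), F.Finite → F ⊆ {p ∈ S | p.2 = i} → ∀ K, ∃ K', ∀ n, 0 < n →
        ∀ g ∈ wordCost (F ∪ {p ∈ S | i + 1 ≤ p.2}) (fun w => n ^ (c - 1 - w)) (K * n ^ c),
          g ∈ (⊤ : Subgroup G).lowerCentralSeries (i + 1) →
            g ∈ wordCost {p ∈ S | i + 1 ≤ p.2} (fun w => n ^ (c - 1 - w)) (K' * n ^ c) := by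
      intro F hF
      induction F, hF using Set.Finite.induction_on with
      | empty => exact fun _ K => ⟨K, fun n _ g hg _ => by simpa using hg⟩
      | @insert p F _ _ ihF =>
        intro hFS K
        have hp : p ∈ S ∧ p.2 = i := hFS (Set.mem_insert _ _)
        have hFS' := (Set.subset_insert p F).trans hFS
        obtain ⟨K₁, h₁⟩ := hS.exists_mem_wordCost_of_insert (x := p.1) (a := i)
          (T := F ∪ {p ∈ S | i + 1 ≤ p.2}) (by rw [← hp.2]; exact hp.1)
          (Set.union_subset (fun q hq => (hFS' hq).1) (fun q hq => hq.1))
          (fun q hq hiq => Or.inr ⟨hq, hiq⟩)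
          (fun q hq => hq.elim (fun h => (hFS' h).2.ge) (fun h => (Nat.le_succ i).trans h.2)) K
        obtain ⟨K₂, h₂⟩ := ihF hFS' K₁
        refine ⟨K₂, fun n hn g hg hgi => h₂ n hn g (h₁ n hn g ?_ ?_) hgi⟩
        · rw [Set.insert_union] at hg
          have : p = (p.1, i) := Prod.ext rfl hp.2
          rwa [this] at hg
        · exact Subgroup.closure_mono (Set.image_mono Set.subset_union_right) (hS.gen _ hgi)
    obtain ⟨K', h'⟩ := key {p ∈ S | p.2 = i} (hS.finite.subset fun p hp => hp.1) subset_rfl K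
    refine ⟨K', fun n hn g hg hgi => h' n hn g (wordCost_mono ?_ le_rfl
      (hK n hn g hg (Subgroup.lowerCentralSeries_antitone _ (Nat.le_succ i) hgi))) hgi⟩
    intro p hp
    rcases hp.2.eq_or_lt with h | h
    exacts [Or.inl ⟨hp.1, h.symm⟩, Or.inr ⟨hp.1, h⟩]

end Extraction

/-! ### Large powers in balls -/

section BallPowers

/-- The homomorphisms to `ℤ` detect the elements of infinite order of a finitely generated
commutative group. -/
theorem exists_homs_int_of_fg (Q : Type*) [CommGroup Q] [Group.FG Q] :
    ∃ (r : ℕ) (f : Fin r → Q →* Multiplicative ℤ), ∀ q, (∀ k, f k q = 1) → IsOfFinOrder q := by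
  let M := Additive Q
  have : Module.Finite ℤ M := Module.Finite.iff_addGroup_fg.2 inferInstance
  let N := M ⧸ Submodule.torsion ℤ M
  let b := Module.Free.chooseBasis ℤ N
  let e := Fintype.equivFin (Module.Free.ChooseBasisIndex ℤ N)
  refine ⟨_, fun k => AddMonoidHom.toMultiplicativeRight
    ((b.coord (e.symm k)).comp (Submodule.torsion ℤ M).mkQ).toAddMonoidHom, fun q hq => ?_⟩
  have h0 : (Submodule.torsion ℤ M).mkQ (Additive.ofMul q) = 0 := by
    refine b.ext_elem fun k => ?_
    have := hq (e k)
    simpa using! this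
  rw [Submodule.mkQ_apply, Submodule.Quotient.mk_eq_zero, Submodule.mem_torsion_iff] at h0
  obtain ⟨⟨z, hz⟩, hzq⟩ := h0
  refine isOfFinOrder_iff_zpow_eq_one.2 ⟨z, nonZeroDivisors.ne_zero hz, ?_⟩
  exact Additive.ofMul.injective hzq

theorem exists_homs_int_of_fg_of_comm (Q : Type*) [hQ : Group Q] [Group.FG Q]
    (h : ∀ a b : Q, a * b = b * a) :
    ∃ (r : ℕ) (f : Fin r → Q →* Multiplicative ℤ), ∀ q, (∀ k, f k q = 1) → IsOfFinOrder q :=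
  letI : CommGroup Q := { hQ with mul_comm := h }
  exists_homs_int_of_fg Q

/-- An element of the ball of radius `n` that is, modulo `lcs (i + 1)`, an `M ^ (i + 1)`-th power of
an element `a` of `lcs i` with `M` large compared to `n` is such a power only for a trivial reason:
`a` is a torsion element modulo `lcs (i + 1)`. -/
theorem exists_pow_mem_of_mem_wordBall {G : Type*} [Group G] (X : Finset G)
    (hX : Subgroup.closure (X : Set G) = ⊤) {c : ℕ}
    (hc : (⊤ : Subgroup G).lowerCentralSeries c = ⊥) (i : ℕ) :
    ∃ C : ℕ, 0 < C ∧ ∀ n, 0 < n → ∀ M, C * n < M → ∀ g ∈ wordBall X n,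
      ∀ a ∈ (⊤ : Subgroup G).lowerCentralSeries i, g ∈ (⊤ : Subgroup G).lowerCentralSeries i →
        g⁻¹ * a ^ M ^ (i + 1) ∈ (⊤ : Subgroup G).lowerCentralSeries (i + 1) →
          ∃ t, 0 < t ∧ a ^ t ∈ (⊤ : Subgroup G).lowerCentralSeries (i + 1) := by
  rcases le_or_gt c i with hi | hi
  · refine ⟨1, one_pos, fun n _ M _ g _ a ha _ _ => ⟨1, one_pos, ?_⟩⟩
    have := Subgroup.lowerCentralSeries_antitone _ hi ha
    rw [hc, Subgroup.mem_bot] at this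
    simp [this]
  obtain ⟨S, hS⟩ := exists_isWeightedGenerating X hX hc
  set L := (⊤ : Subgroup G).lowerCentralSeries i
  set N := (⊤ : Subgroup G).lowerCentralSeries (i + 1)
  have hmemL : ∀ p ∈ {p ∈ S | i ≤ p.2}, p.1 ∈ L := fun p hp =>
    Subgroup.lowerCentralSeries_antitone _ hp.2 (hS.mem p hp.1)
  have hL : L = Subgroup.closure (Prod.fst '' {p ∈ S | i ≤ p.2}) := by
    refine le_antisymm (hS.gen i) ((Subgroup.closure_le _).2 ?_)
    rintro _ ⟨p, hp, rfl⟩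
    exact hmemL p hp
  have hfin : {p ∈ S | i ≤ p.2}.Finite := hS.finite.subset fun p hp => hp.1
  have : Group.FG L := by
    rw [Group.fg_iff_subgroup_fg, hL]
    exact Subgroup.fg_iff _ |>.2 ⟨_, rfl, hfin.image _⟩
  obtain ⟨r, f, hf⟩ := exists_homs_int_of_fg_of_comm (L ⧸ N.subgroupOf L) (fun a b => by
    obtain ⟨a, rfl⟩ := QuotientGroup.mk_surjective a
    obtain ⟨b, rfl⟩ := QuotientGroup.mk_surjective b
    rw [← commutatorElement_eq_one_iff_mul_comm]
    refine (QuotientGroup.eq_one_iff ⁅a, b⁆).2 ?_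
    rw [Subgroup.mem_subgroupOf]
    exact mem_lowerCentralSeries_commutator (j := 0) a.2 trivial)
  let F : Fin r → L →* Multiplicative ℤ := fun k => (f k).comp (QuotientGroup.mk' _)
  have hFN : ∀ k (y : L), (y : G) ∈ N → F k y = 1 := fun k y hy => by
    have : QuotientGroup.mk' (N.subgroupOf L) y = 1 :=
      (QuotientGroup.eq_one_iff y).2 (Subgroup.mem_subgroupOf.2 hy)
    simp only [F, MonoidHom.comp_apply, this, map_one]
  obtain ⟨B, hB⟩ := hfin.exists_nat_forall
    (P := fun p B => ∀ k (hp : p.1 ∈ L), (F k ⟨p.1, hp⟩).toAdd.natAbs ≤ B)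
    (fun p m m' hm h k hp => (h k hp).trans hm)
    (fun p hp => ⟨∑ k, (F k ⟨p.1, hmemL p hp⟩).toAdd.natAbs, fun k _ =>
      Finset.single_le_sum (f := fun k => (F k ⟨p.1, hmemL p hp⟩).toAdd.natAbs)
        (fun _ _ => Nat.zero_le _) (Finset.mem_univ k)⟩)
  obtain ⟨K, hK⟩ := hS.exists_wordBall_subset X (by omega) i
  refine ⟨B * K + 1, Nat.succ_pos _, fun n hn M hM g hgX a ha hg hga => ?_⟩
  have hbound : ∀ k, (F k ⟨g, hg⟩).toAdd.natAbs ≤ B * K * n ^ (i + 1) := by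
    intro k
    obtain ⟨_, h⟩ := natAbs_le_of_mem_wordCost (F k) (u := n ^ (c - 1 - i)) (B := B)
      (fun p hp => ⟨hmemL p hp, by
        rcases hp.2.eq_or_lt with h | h
        · rw [← h]
          exact Nat.mul_le_mul_right _ (hB p hp k _)
        · rw [hFN k _ (Subgroup.lowerCentralSeries_antitone _ h (hS.mem p hp.1))]
          simp⟩) (hK n hn g hgX hg)
    have hc : n ^ c = n ^ (i + 1) * n ^ (c - 1 - i) := by rw [← pow_add]; congr 1; omega
    rw [hc, ← mul_assoc, ← mul_assoc] at h
    exact Nat.le_of_mul_le_mul_right h (by positivity)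
  -- The value of `F k` at `g` is `M ^ (i + 1)` times its value at `a`, yet is smaller than `M ^ (i
  -- + 1)` in absolute value.
  have hzero : ∀ k, F k ⟨a, ha⟩ = 1 := by
    intro k
    have h1 := hFN k (⟨g, hg⟩⁻¹ * ⟨a, ha⟩ ^ M ^ (i + 1)) hga
    rw [map_mul, map_inv, inv_mul_eq_one, map_pow] at h1
    have h2 := hbound k
    rw [h1, toAdd_pow, nsmul_eq_mul, Int.natAbs_mul, Int.natAbs_natCast] at h2
    by_contra h3
    have h4 : 0 < (F k ⟨a, ha⟩).toAdd.natAbs := Int.natAbs_pos.2 h3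
    have h5 : M ^ (i + 1) ≤ B * K * n ^ (i + 1) := (Nat.le_mul_of_pos_right _ h4).trans h2
    have h6 : ((B * K + 1) * n) ^ (i + 1) < M ^ (i + 1) := Nat.pow_lt_pow_left hM (by omega)
    have h7 : B * K * n ^ (i + 1) ≤ ((B * K + 1) * n) ^ (i + 1) := by
      rw [mul_pow]
      refine Nat.mul_le_mul_right _ ((Nat.le_succ _).trans ?_)
      exact Nat.le_self_pow (by omega) _
    omega
  obtain ⟨t, ht, hta⟩ := isOfFinOrder_iff_pow_eq_one.1 (hf (QuotientGroup.mk' _ ⟨a, ha⟩) hzero)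
  refine ⟨t, ht, ?_⟩
  rw [← map_pow] at hta
  exact Subgroup.mem_subgroupOf.1 ((QuotientGroup.eq_one_iff _).1 hta)

end BallPowers

/-! ### Subgroups generated by powers -/

section PowerSubgroups

variable {G : Type*} [Group G]

/-- The subgroup generated by the `M`-th powers of the elements of `K`. -/
def powSubgroup (M : ℕ) (K : Subgroup G) : Subgroup G :=
  Subgroup.closure ((fun x => x ^ M) '' (K : Set G))

theorem pow_mem_powSubgroup {M : ℕ} {K : Subgroup G} {x : G} (hx : x ∈ K) :
    x ^ M ∈ powSubgroup M K := Subgroup.subset_closure ⟨x, hx, rfl⟩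

theorem powSubgroup_le (M : ℕ) (K : Subgroup G) : powSubgroup M K ≤ K := by
  rw [powSubgroup, Subgroup.closure_le]
  rintro _ ⟨x, hx, rfl⟩
  exact pow_mem hx M

theorem powSubgroup_normal (M : ℕ) (K : Subgroup G) [K.Normal] : (powSubgroup M K).Normal := by
  refine ⟨fun n hn g => ?_⟩
  have h : (powSubgroup M K).map (MulAut.conj g).toMonoidHom ≤ powSubgroup M K := by
    rw [powSubgroup, MonoidHom.map_closure, Subgroup.closure_le]
    rintro _ ⟨_, ⟨x, hx, rfl⟩, rfl⟩
    simp only [MulEquiv.toMonoidHom_eq_coe, MonoidHom.coe_coe, map_pow]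
    exact pow_mem_powSubgroup (by simpa using Subgroup.Normal.conj_mem inferInstance x hx g)
  exact h ⟨n, hn, by simp⟩

theorem exists_mem_pow_eq_of_mem_powSubgroup.{u} {G : Type u} [Group G] {c k : ℕ}
    (hk : ∀ (H : Type u) [Group H], (⊤ : Subgroup H).lowerCentralSeries c = ⊥ → ∀ (M : ℕ),
      ∀ g ∈ Subgroup.closure (Set.range fun x : H => x ^ (k * M)), ∃ y, g = y ^ M)
    (hc : (⊤ : Subgroup G).lowerCentralSeries c = ⊥) (K : Subgroup G) (M : ℕ) {g : G}
    (hg : g ∈ powSubgroup (k * M) K) : ∃ y ∈ K, g = y ^ M := by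
  have hK : (⊤ : Subgroup K).lowerCentralSeries c = ⊥ := by
    rw [← Subgroup.map_eq_bot_iff_of_injective _ K.subtype_injective,
      Subgroup.top_subtype_lowerCentralSeries, ← le_bot_iff, ← hc]
    exact Subgroup.lowerCentralSeries_mono c le_top
  have h : powSubgroup (k * M) K =
      (Subgroup.closure (Set.range fun x : K => x ^ (k * M))).map K.subtype := by
    rw [powSubgroup, MonoidHom.map_closure, ← Set.range_comp]
    congr 1
    ext y
    simp
  rw [h] at hg
  obtain ⟨g, hg, rfl⟩ := hg
  obtain ⟨y, rfl⟩ := hk K hK M g hg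
  exact ⟨y, y.2, rfl⟩

/-- The product of the subgroups of `(q ^ i)`-th powers in `H i`, for `1 ≤ i ≤ r`. -/
def powProduct (H : ℕ → Subgroup G) (q : ℕ) : ℕ → Subgroup G
  | 0 => ⊥
  | r + 1 => powSubgroup (q ^ (r + 1)) (H (r + 1)) ⊔ powProduct H q r

theorem powProduct_normal {H : ℕ → Subgroup G} (q : ℕ) {r : ℕ} (hH : ∀ i ≤ r, (H i).Normal) :
    (powProduct H q r).Normal := by
  induction r with
  | zero => exact inferInstanceAs (⊥ : Subgroup G).Normal
  | succ r ih =>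
    have := hH (r + 1) le_rfl
    have := ih fun i hi => hH i (by omega)
    have := powSubgroup_normal (q ^ (r + 1)) (H (r + 1))
    exact Subgroup.sup_normal _ _

theorem powProduct_le {H : ℕ → Subgroup G} (q : ℕ) {r : ℕ} (hH : ∀ i < r, H i ≤ H (i + 1)) :
    powProduct H q r ≤ H r := by
  induction r with
  | zero => exact bot_le
  | succ r ih =>
    exact sup_le (powSubgroup_le _ _)
      ((ih fun i hi => hH i (by omega)).trans (hH r (by omega)))

theorem powSubgroup_le_powProduct (H : ℕ → Subgroup G) (q : ℕ) {i r : ℕ} (hi : 0 < i)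
    (hir : i ≤ r) : powSubgroup (q ^ i) (H i) ≤ powProduct H q r := by
  induction r, hir using Nat.le_induction with
  | base =>
    obtain ⟨i, rfl⟩ : ∃ j, i = j + 1 := ⟨i - 1, by omega⟩
    exact le_sup_left
  | succ r _ ih => exact ih.trans le_sup_right

end PowerSubgroups

/-! ### Central elements of the product of power subgroups -/

section Terraces

open scoped IsMulCommutative

/-- A terraced filtration of a nilpotent group of class at most `c`, extended by `H c = G`. -/
structure IsTerrace {G : Type*} [Group G] (c : ℕ) (H : ℕ → Subgroup G) : Prop where
  zero_eq : H 0 = ⊥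
  last_eq : H c = ⊤
  le_succ : ∀ i < c, H i ≤ H (i + 1)
  normal : ∀ i ≤ c, (H i).Normal
  inf_eq_bot : ∀ i ≤ c, H i ⊓ (⊤ : Subgroup G).lowerCentralSeries i = ⊥
  le_of_inf_eq_bot : ∀ i < c, ∀ K : Subgroup G, K.Normal →
    K ⊓ (⊤ : Subgroup G).lowerCentralSeries i = ⊥ → H i ≤ K → K ≤ H i

variable {G : Type*} [Group G] {c : ℕ} {H : ℕ → Subgroup G}

/-- The torsion of the finitely generated nilpotent group `G ⧸ K` has bounded exponent. -/
theorem exists_pow_mem_of_pow_mem [Group.IsNilpotent G] (X : Finset G)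
    (hX : Subgroup.closure (X : Set G) = ⊤) (K : Subgroup G) [K.Normal] :
    ∃ e : ℕ, 0 < e ∧ ∀ (y : G) (z : ℤ), z ≠ 0 → y ^ z ∈ K → y ^ e ∈ K := by
  classical
  obtain ⟨n, S, hS⟩ := exists_isCyclicSeries (X.image (QuotientGroup.mk' K)) (by
    rw [Finset.coe_image, ← MonoidHom.map_closure, hX, ← MonoidHom.range_eq_map,
      QuotientGroup.range_mk'])
  obtain ⟨e, he, h⟩ := exists_pow_eq_one_of_isOfFinOrder hS
  refine ⟨e, he, fun y z hz hy => ?_⟩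
  have := h (QuotientGroup.mk y) (isOfFinOrder_iff_zpow_eq_one.2 ⟨z, hz, by
    rw [← QuotientGroup.mk_zpow]; exact (QuotientGroup.eq_one_iff _).2 hy⟩)
  rw [← QuotientGroup.mk_pow] at this
  exact (QuotientGroup.eq_one_iff _).1 this

/-- If a power of `y` is central modulo `H i`, then a bounded power of `y` lies in
`lcs i * H i`. -/
theorem IsTerrace.exists_pow_mem_sup [Group.IsNilpotent G] (hH : IsTerrace c H) (X : Finset G)
    (hX : Subgroup.closure (X : Set G) = ⊤) {i : ℕ} (hi : i < c) :
    ∃ e : ℕ, 0 < e ∧ ∀ (y : G) (M : ℕ), 0 < M → (∀ g, ⁅y ^ M, g⁆ ∈ H i) →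
      y ^ e ∈ (⊤ : Subgroup G).lowerCentralSeries i ⊔ H i := by
  have := hH.normal i hi.le
  obtain ⟨e, he, h⟩ := exists_pow_mem_of_pow_mem X hX
    ((⊤ : Subgroup G).lowerCentralSeries i ⊔ H i)
  refine ⟨e, he, fun y M hM hy => ?_⟩
  suffices ∃ z : ℤ, z ≠ 0 ∧ y ^ z ∈ (⊤ : Subgroup G).lowerCentralSeries i ⊔ H i by
    obtain ⟨z, hz, hyz⟩ := this
    exact h y z hz hyz
  have hmemC : ∀ k, k ∈ (Subgroup.center (G ⧸ H i)).comap (QuotientGroup.mk' (H i)) ↔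
      ∀ g, ⁅k, g⁆ ∈ H i := by
    intro k
    rw [Subgroup.mem_comap, Subgroup.mem_center_iff,
      (QuotientGroup.mk'_surjective (H i)).forall]
    refine forall_congr' fun g => ?_
    rw [eq_comm, ← commutatorElement_eq_one_iff_mul_comm, ← map_commutatorElement]
    exact QuotientGroup.eq_one_iff _
  set K := Subgroup.zpowers (y ^ M) ⊔ H i
  have hKC : K ≤ (Subgroup.center (G ⧸ H i)).comap (QuotientGroup.mk' (H i)) := by
    refine sup_le ?_ fun k hk => ?_
    · rw [Subgroup.zpowers_le]
      exact (hmemC _).2 hy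
    · exact (hmemC _).2 fun g =>
        Subgroup.commutator_le_left _ _ (Subgroup.commutator_mem_commutator hk (Subgroup.mem_top g))
  have hK : K.Normal := by
    rw [← Subgroup.commutator_top_right_le_iff, Subgroup.commutator_le]
    exact fun k hk g _ => Subgroup.mem_sup_right ((hmemC k).1 (hKC hk) g)
  -- Either maximality of `H i` absorbs `y ^ M`, or a nontrivial element of the intersection
  -- exhibits a nonzero power of `y ^ M` in `lcs i * H i`.
  by_cases hKi : K ⊓ (⊤ : Subgroup G).lowerCentralSeries i = ⊥
  · refine ⟨M, by omega, Subgroup.mem_sup_right ?_⟩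
    rw [zpow_natCast]
    exact hH.le_of_inf_eq_bot i hi K hK hKi le_sup_right
      (Subgroup.mem_sup_left (Subgroup.mem_zpowers _))
  · obtain ⟨⟨k, hkK, hki⟩, hk1⟩ := Subgroup.ne_bot_iff_exists_ne_one.1 hKi
    replace hk1 : k ≠ 1 := fun h => hk1 (Subtype.ext h)
    obtain ⟨w, hw, b, hb, hwb⟩ := Subgroup.mem_sup_of_normal_right.1 hkK
    obtain ⟨z, rfl⟩ := Subgroup.mem_zpowers_iff.1 hw
    have hz : z ≠ 0 := by
      rintro rfl
      rw [zpow_zero, one_mul] at hwb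
      have : k ∈ H i ⊓ (⊤ : Subgroup G).lowerCentralSeries i := ⟨hwb ▸ hb, hki⟩
      rw [hH.inf_eq_bot i hi.le, Subgroup.mem_bot] at this
      exact hk1 this
    refine ⟨M * z, mul_ne_zero (by omega) hz, ?_⟩
    rw [zpow_mul, zpow_natCast, eq_mul_inv_of_mul_eq hwb]
    exact mul_mem (Subgroup.mem_sup_left hki) (Subgroup.mem_sup_right (inv_mem hb))

/-- Its commutators lie in `H (j + 1) ⊓ lcs (j + 1)`, which is trivial. -/
theorem IsTerrace.mem_center (hH : IsTerrace c H) {j : ℕ} (hj : j < c) {a : G}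
    (ha : a ∈ (⊤ : Subgroup G).lowerCentralSeries j) (ha' : a ∈ H (j + 1)) :
    a ∈ Subgroup.center G := by
  rw [Subgroup.mem_center_iff]
  intro g
  have := hH.normal (j + 1) hj
  have h : ⁅a, g⁆ ∈ H (j + 1) ⊓ (⊤ : Subgroup G).lowerCentralSeries (j + 1) :=
    ⟨Subgroup.commutator_le_left _ _ (Subgroup.commutator_mem_commutator ha' (Subgroup.mem_top g)),
      mem_lowerCentralSeries_commutator (j := 0) ha trivial⟩
  rw [hH.inf_eq_bot (j + 1) hj, Subgroup.mem_bot, commutatorElement_eq_one_iff_mul_comm] at h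
  exact h.symm

/-- For suitable exponents, the central elements of the product of the power subgroups of a terraced
filtration are products of powers of elements of `lcs j ⊓ H (j + 1)`. -/
theorem IsTerrace.exists_eq_prod_pow [Group.IsNilpotent G] (hH : IsTerrace c H) (X : Finset G)
    (hX : Subgroup.closure (X : Set G) = ⊤)
    (hc : (⊤ : Subgroup G).lowerCentralSeries c = ⊥) :
    ∃ K : ℕ, 0 < K ∧ ∀ m, 0 < m → ∀ z ∈ powProduct H (K * m) c, z ∈ Subgroup.center G →
      ∃ a : ℕ → Subgroup.center G,
        (∀ j < c, (a j : G) ∈ (⊤ : Subgroup G).lowerCentralSeries j ⊓ H (j + 1)) ∧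
        z = ((∏ j ∈ Finset.range c, a j ^ m ^ (j + 1) : Subgroup.center G) : G) := by
  obtain ⟨k, hk, hpow⟩ := exists_eq_pow_of_mem_closure_pow c
  obtain ⟨e, he, hroot⟩ : ∃ e : ℕ, 0 < e ∧ ∀ i < c, ∀ (y : G) (M : ℕ), 0 < M →
      (∀ g, ⁅y ^ M, g⁆ ∈ H i) → y ^ e ∈ (⊤ : Subgroup G).lowerCentralSeries i ⊔ H i := by
    choose! e he h using fun i (hi : i < c) => hH.exists_pow_mem_sup X hX hi
    refine ⟨∏ i ∈ Finset.range c, e i, Finset.prod_pos fun i hi => he i (Finset.mem_range.1 hi),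
      fun i hi y M hM hy => ?_⟩
    obtain ⟨d, hd⟩ := Finset.dvd_prod_of_mem e (Finset.mem_range.2 hi)
    rw [hd, pow_mul]
    exact pow_mem (h i hi y M hM hy) d
  refine ⟨k * e, by positivity, fun m hm => ?_⟩
  suffices ∀ i ≤ c, ∀ z ∈ powProduct H (k * e * m) i, z ∈ Subgroup.center G →
      ∃ a : ℕ → Subgroup.center G,
        (∀ j < i, (a j : G) ∈ (⊤ : Subgroup G).lowerCentralSeries j ⊓ H (j + 1)) ∧
        z = ((∏ j ∈ Finset.range i, a j ^ m ^ (j + 1) : Subgroup.center G) : G) from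
    this c le_rfl
  intro i
  induction i with
  | zero =>
    intro _ z hz _
    have : z = 1 := Subgroup.mem_bot.1 hz
    exact ⟨1, by simp, by simp [this]⟩
  | succ i ih =>
    intro hi z hz hzc
    have := hH.normal i (by omega)
    have := hH.normal (i + 1) hi
    have hR := powProduct_normal (k * e * m) (r := i) fun j hj => hH.normal j (by omega)
    obtain ⟨p, hp, r, hr, rfl⟩ := Subgroup.mem_sup_of_normal_right.1 hz
    have hrH : r ∈ H i := powProduct_le _ (fun j hj => hH.le_succ j (by omega)) hr
    -- The factor `k` is spent on extracting a single power `y`, and `e` on moving `y` into `lcs i *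
    -- H i`.
    have hexp : (k * e * m) ^ (i + 1) = k * (e * ((k * e) ^ i * m ^ (i + 1))) := by ring
    rw [hexp] at hp
    obtain ⟨y, hy, rfl⟩ := exists_mem_pow_eq_of_mem_powSubgroup hpow hc _ _ hp
    have hye : y ^ e ∈ (⊤ : Subgroup G).lowerCentralSeries i ⊔ H i := by
      refine hroot i hi y (e * ((k * e) ^ i * m ^ (i + 1))) (by positivity) fun g => ?_
      have h1 := Subgroup.mem_center_iff.1 hzc g
      set p := y ^ (e * ((k * e) ^ i * m ^ (i + 1)))
      have h2 : ⁅p, g⁆ = p * (g * r * g⁻¹) * p⁻¹ * (p * r⁻¹ * p⁻¹) := by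
        have h4 : g * p = p * r * g * r⁻¹ := by rw [← h1]; group
        rw [commutatorElement_def]
        have h5 : p⁻¹ * g⁻¹ = (p * r * g * r⁻¹)⁻¹ := by rw [← h4]; group
        rw [mul_assoc (p * g), h5]
        group
      rw [h2]
      exact mul_mem (Subgroup.Normal.conj_mem inferInstance _
        (Subgroup.Normal.conj_mem inferInstance _ hrH _) _)
        (Subgroup.Normal.conj_mem inferInstance _ (inv_mem hrH) _)
    obtain ⟨a, ha, b, hb, hab⟩ := Subgroup.mem_sup_of_normal_right.1 hye
    have haH : a ∈ H (i + 1) := by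
      rw [eq_mul_inv_of_mul_eq hab]
      exact mul_mem (pow_mem hy e) (inv_mem (hH.le_succ i hi hb))
    have hac := hH.mem_center hi ha haH
    have hcomm : Commute a b := (Subgroup.mem_center_iff.1 hac b).symm
    set s := (k * e) ^ i * m ^ (i + 1) with hs
    -- The remaining exponent is `s = (k * e * m) ^ i * m`, so `b ^ s` joins `r` in the smaller
    -- product, ready for the induction.
    have hbR : b ^ s ∈ powProduct H (k * e * m) i := by
      rcases Nat.eq_zero_or_pos i with rfl | hi0
      · rw [hH.zero_eq, Subgroup.mem_bot] at hb
        simp [hb]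
      · have : b ^ s = (b ^ m) ^ (k * e * m) ^ i := by
          rw [← pow_mul, hs]; congr 1; ring
        rw [this]
        exact powSubgroup_le_powProduct H _ hi0 le_rfl (pow_mem_powSubgroup (pow_mem hb m))
    have hz' : y ^ (e * s) * r = a ^ s * (b ^ s * r) := by
      rw [pow_mul, ← hab, hcomm.mul_pow, mul_assoc]
    rw [hz'] at hzc ⊢
    have hzc' : b ^ s * r ∈ Subgroup.center G :=
      (Subgroup.mul_mem_cancel_left _ (pow_mem hac s)).1 hzc
    obtain ⟨f, hf, hfz⟩ := ih (by omega) _ (mul_mem hbR hr) hzc'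
    refine ⟨fun j => if j = i then ⟨a, hac⟩ ^ (k * e) ^ i else f j, fun j hj => ?_, ?_⟩
    · rcases Nat.lt_succ_iff_lt_or_eq.1 hj with hj | rfl
      · simpa [hj.ne] using hf j hj
      · simpa using ⟨pow_mem ha _, pow_mem haH _⟩
    · rw [Finset.prod_range_succ, mul_comm, Subgroup.coe_mul, hfz]
      congr 1
      · simp [hs, pow_mul]
      · congr 1
        refine Finset.prod_congr rfl fun j hj => ?_
        simp [(Finset.mem_range.1 hj).ne]

end Terraces

/-! ### Trivial intersection with the ball -/

section TrivialIntersection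

theorem wordBall_mono {G : Type*} [Group G] (X : Finset G) {m n : ℕ} (h : m ≤ n) :
    wordBall X m ⊆ wordBall X n := by
  rintro g ⟨l, hl, h'⟩
  exact ⟨l, hl.trans h, h'⟩

theorem mul_mem_wordBall {G : Type*} [Group G] {X : Finset G} {m n : ℕ} {g h : G}
    (hg : g ∈ wordBall X m) (hh : h ∈ wordBall X n) : g * h ∈ wordBall X (m + n) := by
  obtain ⟨l, hl, hlX, rfl⟩ := hg
  obtain ⟨l', hl', hlX', rfl⟩ := hh
  refine ⟨l ++ l', by simpa using add_le_add hl hl', fun x hx => ?_, by simp⟩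
  rcases List.mem_append.1 hx with hx | hx
  exacts [hlX x hx, hlX' x hx]

theorem inv_mem_wordBall {G : Type*} [Group G] {X : Finset G} {n : ℕ} {g : G}
    (hg : g ∈ wordBall X n) : g⁻¹ ∈ wordBall X n := by
  obtain ⟨l, hl, hlX, rfl⟩ := hg
  refine ⟨(l.map (·⁻¹)).reverse, by simpa using hl, fun x hx => ?_, ?_⟩
  · obtain ⟨y, hy, rfl⟩ := List.mem_map.1 (List.mem_reverse.1 hx)
    simpa using (hlX y hy).symm
  · rw [List.prod_inv_reverse]

/-- Iterated commutators with generators move a nontrivial element of a normal subgroup into the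
center. -/
theorem exists_mem_center_of_mem_wordBall {G : Type*} [Group G] {X : Finset G}
    (hX : Subgroup.closure (X : Set G) = ⊤) {c : ℕ}
    (hc : (⊤ : Subgroup G).lowerCentralSeries c = ⊥) (N : Subgroup G) [N.Normal] {i : ℕ}
    (hi : i ≤ c) : ∀ n, 0 < n → ∀ g ∈ wordBall X n, g ∈ N →
      g ∈ (⊤ : Subgroup G).lowerCentralSeries i → g ≠ 1 →
        ∃ z ∈ wordBall X (4 ^ (c - i) * n), z ∈ N ∧ z ∈ Subgroup.center G ∧ z ≠ 1 := by
  induction hi using Nat.decreasingInduction with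
  | self =>
    intro n _ g _ _ hgi hg1
    rw [hc, Subgroup.mem_bot] at hgi
    exact absurd hgi hg1
  | of_succ i hi ih =>
    intro n hn g hg hgN hgi hg1
    by_cases hgc : g ∈ Subgroup.center G
    · exact ⟨g, wordBall_mono X (Nat.le_mul_of_pos_left _ (by positivity)) hg, hgN, hgc, hg1⟩
    obtain ⟨x, hxX, hx⟩ : ∃ x ∈ X, ⁅g, x⁆ ≠ 1 := by
      by_contra! h
      refine hgc (Subgroup.mem_center_iff.2 fun y => ?_)
      have hle : Subgroup.closure (X : Set G) ≤ Subgroup.centralizer {g} := by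
        rw [Subgroup.closure_le]
        intro x hx
        exact Subgroup.mem_centralizer_singleton_iff.2
          (commutatorElement_eq_one_iff_mul_comm.1 (h x hx)).symm
      exact Subgroup.mem_centralizer_singleton_iff.1 (hle (hX ▸ Subgroup.mem_top y))
    have hxb : x ∈ wordBall X 1 := ⟨[x], by simp, by simp [hxX], by simp⟩
    have hball : ⁅g, x⁆ ∈ wordBall X (4 * n) := by
      rw [commutatorElement_def]
      exact wordBall_mono X (by omega) (mul_mem_wordBall (mul_mem_wordBall
        (mul_mem_wordBall hg hxb) (inv_mem_wordBall hg)) (inv_mem_wordBall hxb))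
    obtain ⟨z, hz, h⟩ := ih (4 * n) (by omega) ⁅g, x⁆ hball
      (Subgroup.commutator_le_left _ _ (Subgroup.commutator_mem_commutator hgN (Subgroup.mem_top x)))
      (mem_lowerCentralSeries_commutator (j := 0) hgi trivial) hx
    refine ⟨z, ?_, h⟩
    rwa [← mul_assoc, ← pow_succ, show c - (i + 1) + 1 = c - i by omega] at hz

open scoped IsMulCommutative in
/-- For exponents `m` that are large compared to `n`, and divisible enough, the product of the power
subgroups of a terraced filtration meets the ball of radius `n` trivially. -/
theorem IsTerrace.exists_powProduct_inter_wordBall {G : Type*} [Group G] [Group.IsNilpotent G]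
    {c : ℕ} {H : ℕ → Subgroup G} (hH : IsTerrace c H) (X : Finset G)
    (hX : Subgroup.closure (X : Set G) = ⊤)
    (hc : (⊤ : Subgroup G).lowerCentralSeries c = ⊥) :
    ∃ K e C : ℕ, 0 < K ∧ 0 < e ∧ ∀ m n, 0 < n → e ∣ m → C * n < m → ∀ g ∈ wordBall X n,
      g ∈ powProduct H (K * m) c → g = 1 := by
  obtain ⟨K, hK, hprod⟩ := hH.exists_eq_prod_pow X hX hc
  obtain ⟨r, S, hS⟩ := exists_isCyclicSeries X hX
  obtain ⟨e, he, htors⟩ := exists_pow_eq_one_of_isOfFinOrder hS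
  choose C _ hC using exists_pow_mem_of_mem_wordBall X hX hc
  refine ⟨K, e, (∑ i ∈ Finset.range c, C i) * 4 ^ c, hK, he, fun m n hn hem hm g hg hgN => ?_⟩
  have hm0 : 0 < m := by omega
  by_contra hg1
  have hN := powProduct_normal (K * m) hH.normal
  obtain ⟨z, hz, hzN, hzc, hz1⟩ := exists_mem_center_of_mem_wordBall hX hc
    (powProduct H (K * m) c) (Nat.zero_le c) n hn g hg hgN trivial hg1
  obtain ⟨a, ha, hza⟩ := hprod m hm0 z hzN hzc
  -- The factors are removed in order of increasing `j`: once those below `l` are gone, `z` lies in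
  -- `lcs l` and equals `a l ^ m ^ (l + 1)` modulo `lcs (l + 1)`.
  suffices ∀ l ≤ c, z = ((∏ j ∈ Finset.Ico l c, a j ^ m ^ (j + 1) : Subgroup.center G) : G) by
    have := this c le_rfl
    simp at this
    exact hz1 this
  intro l
  induction l with
  | zero => intro _; rw [hza, Finset.range_eq_Ico]
  | succ l ih =>
    intro hl
    have ih := ih (by omega)
    have hmem : ∀ i ≤ c, ((∏ j ∈ Finset.Ico i c, a j ^ m ^ (j + 1) : Subgroup.center G) : G) ∈
        (⊤ : Subgroup G).lowerCentralSeries i := by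
      intro i _
      have : ∏ j ∈ Finset.Ico i c, a j ^ m ^ (j + 1) ∈
          ((⊤ : Subgroup G).lowerCentralSeries i).comap (Subgroup.center G).subtype := by
        refine prod_mem fun j hj => pow_mem ?_ _
        rw [Finset.mem_Ico] at hj
        exact Subgroup.lowerCentralSeries_antitone _ hj.1 (ha j hj.2).1
      exact this
    have hzl := hmem l (by omega)
    rw [← ih] at hzl
    have hrest := hmem (l + 1) hl
    rw [Finset.prod_eq_prod_Ico_succ_bot (by omega), Subgroup.coe_mul] at ih
    set p := ((∏ j ∈ Finset.Ico (l + 1) c, a j ^ m ^ (j + 1) : Subgroup.center G) : G)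
    have hal := ha l (by omega)
    obtain ⟨t, ht, hat⟩ := hC l (4 ^ (c - 0) * n) (by positivity) m (by
      refine lt_of_le_of_lt ?_ hm
      rw [mul_assoc, Nat.sub_zero]
      exact Nat.mul_le_mul_right _ (Finset.single_le_sum (f := C) (fun _ _ => Nat.zero_le _)
        (Finset.mem_range.2 (by omega)))) z hz (a l) hal.1 hzl (by
      have : z⁻¹ * (a l : G) ^ m ^ (l + 1) = p⁻¹ := by
        rw [ih]; simp
      rw [this]
      exact inv_mem hrest)
    have hat1 : (a l : G) ^ t = 1 := by
      have : (a l : G) ^ t ∈ H (l + 1) ⊓ (⊤ : Subgroup G).lowerCentralSeries (l + 1) :=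
        ⟨pow_mem hal.2 t, hat⟩
      rwa [hH.inf_eq_bot (l + 1) hl, Subgroup.mem_bot] at this
    have hae := htors (a l) (isOfFinOrder_iff_pow_eq_one.2 ⟨t, ht, hat1⟩)
    obtain ⟨d, hd⟩ := hem.trans (dvd_pow_self m (Nat.succ_ne_zero l))
    have : (a l : G) ^ m ^ (l + 1) = 1 := by rw [hd, pow_mul, hae, one_pow]
    rw [ih, Subgroup.coe_pow, this, one_mul]

end TrivialIntersection

/-! ### Counting in cyclic factors -/

section Index

theorem natCard_le_of_forall_exists {Q : Type*} [Group Q] {A B : Subgroup Q} (hB : Finite B)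
    {x s : Q} {d M : ℕ} (hM : 0 < M) (hs : s ^ M = 1)
    (h : ∀ y ∈ A, ∃ r < d, ∃ z : ℤ, (s ^ z)⁻¹ * (x ^ r)⁻¹ * y ∈ B) :
    Finite A ∧ Nat.card A ≤ d * M * Nat.card B := by
  have h' : ∀ y : A, ∃ p : Fin d × Fin M × B, (y : Q) = x ^ (p.1 : ℕ) * s ^ (p.2.1 : ℕ) * p.2.2 := by
    rintro ⟨y, hy⟩
    obtain ⟨r, hr, z, hz⟩ := h y hy
    have hM' : (0 : ℤ) < M := by omega
    have h1 := Int.emod_nonneg z hM'.ne'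
    have h2 := Int.emod_lt_of_pos z hM'
    refine ⟨⟨⟨r, hr⟩, ⟨(z % M).toNat, by omega⟩, ⟨_, hz⟩⟩, ?_⟩
    have hz' : s ^ (z % M).toNat = s ^ z := by
      rw [← zpow_natCast, Int.toNat_of_nonneg h1]
      conv_rhs => rw [← Int.emod_add_mul_ediv z M, zpow_add, zpow_mul, zpow_natCast, hs, one_zpow,
        mul_one]
    simp only [hz']
    group
  choose f hf using h'
  have hinj : Function.Injective f := fun y y' hyy => Subtype.ext (by rw [hf y, hf y', hyy])
  refine ⟨Finite.of_injective f hinj, (Nat.card_le_card_of_injective f hinj).trans ?_⟩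
  rw [Nat.card_prod, Nat.card_prod, Nat.card_fin, Nat.card_fin, mul_assoc]

theorem isCyclic_quotient_of_eq_ker {A Q : Type*} [Group A] [Group Q] [IsCyclic Q]
    {K : Subgroup A} (φ : A →* Q) (hK : K = φ.ker) :
    ∃ _ : K.Normal, IsCyclic (A ⧸ K) ∧ (Infinite (A ⧸ K) → Infinite Q ∧ K ≠ ⊤) := by
  subst hK
  refine ⟨inferInstance, isCyclic_of_injective _ (QuotientGroup.kerLift_injective φ),
    fun h => ⟨Infinite.of_injective _ (QuotientGroup.kerLift_injective φ), fun htop => ?_⟩⟩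
  have : Subsingleton (A ⧸ φ.ker) := by
    rw [htop]
    exact QuotientGroup.subsingleton_quotient_top
  exact not_finite (A ⧸ φ.ker)

-- Intersect the series with `H`; its factors embed in those of `S`. As `groupDim` is an infimum,
-- any series gives an upper bound, and the invariance of the dimension is never needed.
open Classical in
theorem groupDim_le_card {G : Type*} [Group G] {n : ℕ} {S : ℕ → Subgroup G}
    (hS : IsCyclicSeries n S) (H : Subgroup G) :
    groupDim H ≤ (((Finset.range n).filter
      fun i => Infinite (S i ⧸ (S (i + 1)).subgroupOf (S i))).filter
        fun i => ¬ S i ⊓ H ≤ S (i + 1)).card := by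
  have key : ∀ i < n, ∃ _ : (((S (i + 1)).subgroupOf H).subgroupOf ((S i).subgroupOf H)).Normal,
      IsCyclic ((S i).subgroupOf H ⧸ ((S (i + 1)).subgroupOf H).subgroupOf ((S i).subgroupOf H)) ∧
      (Infinite ((S i).subgroupOf H ⧸
        ((S (i + 1)).subgroupOf H).subgroupOf ((S i).subgroupOf H)) →
        Infinite (S i ⧸ (S (i + 1)).subgroupOf (S i)) ∧
          ((S (i + 1)).subgroupOf H).subgroupOf ((S i).subgroupOf H) ≠ ⊤) := by
    intro i hi
    obtain ⟨_, _⟩ := hS.cyclic i hi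
    refine isCyclic_quotient_of_eq_ker ((QuotientGroup.mk' ((S (i + 1)).subgroupOf (S i))).comp
      ((H.subtype.comp ((S i).subgroupOf H).subtype).codRestrict (S i) fun x => x.2)) ?_
    rw [← MonoidHom.comap_ker, QuotientGroup.ker_mk']
    rfl
  have hcs : IsCyclicSeries n fun i => (S i).subgroupOf H :=
    { zero_eq := by simp [hS.zero_eq]
      last_eq := by simp [hS.last_eq]
      succ_le := fun i hi => Subgroup.comap_mono (hS.succ_le i hi)
      cyclic := fun i hi => ⟨(key i hi).1, (key i hi).2.1⟩ }
  have hle : groupDim H ≤ _ := Nat.sInf_le ⟨n, _, hcs, rfl⟩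
  refine hle.trans (Finset.card_le_card fun i hi => ?_)
  rw [Finset.mem_filter, Finset.mem_range] at hi
  obtain ⟨hinf, hne⟩ := (key i hi.1).2.2 hi.2
  rw [Finset.mem_filter, Finset.mem_filter, Finset.mem_range]
  refine ⟨⟨hi.1, hinf⟩, fun hle => hne ?_⟩
  rw [eq_top_iff]
  intro x _
  exact hle ⟨x.2, x.1.2⟩

/-- A finite factor of a series is covered by finitely many powers of one element. -/
theorem exists_forall_exists_pow_of_finite {G : Type*} [Group G] {A B : Subgroup G}
    [(B.subgroupOf A).Normal] [IsCyclic (A ⧸ B.subgroupOf A)] [Finite (A ⧸ B.subgroupOf A)] :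
    ∃ (d : ℕ) (x : G), 0 < d ∧ ∀ y ∈ A, ∃ r < d, (x ^ r)⁻¹ * y ∈ B := by
  classical
  obtain ⟨q, hq⟩ := IsCyclic.exists_generator (α := A ⧸ B.subgroupOf A)
  obtain ⟨x, rfl⟩ := QuotientGroup.mk_surjective q
  refine ⟨orderOf (QuotientGroup.mk x : A ⧸ B.subgroupOf A), x, orderOf_pos _, fun y hy => ?_⟩
  obtain ⟨r, hr, h⟩ := Finset.mem_image.1
    (mem_zpowers_iff_mem_range_orderOf.1 (hq (QuotientGroup.mk ⟨y, hy⟩)))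
  refine ⟨r, Finset.mem_range.1 hr, ?_⟩
  rw [← QuotientGroup.mk_pow] at h
  exact Subgroup.mem_subgroupOf.1 (QuotientGroup.eq.1 h)

/-- An infinite cyclic factor is covered by finitely many cosets of the subgroup generated by a
nontrivial element. -/
theorem exists_forall_exists_zpow_of_infinite {G : Type*} [Group G] {A B : Subgroup G}
    [(B.subgroupOf A).Normal] [IsCyclic (A ⧸ B.subgroupOf A)] {s : G} (hsA : s ∈ A) (hsB : s ∉ B) :
    ∃ (d : ℕ) (x : G), 0 < d ∧ ∀ y ∈ A, ∃ r < d, ∃ z : ℤ, (s ^ z)⁻¹ * (x ^ r)⁻¹ * y ∈ B := by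
  obtain ⟨q, hq⟩ := IsCyclic.exists_generator (α := A ⧸ B.subgroupOf A)
  obtain ⟨x, rfl⟩ := QuotientGroup.mk_surjective q
  obtain ⟨d, hd⟩ := Subgroup.mem_zpowers_iff.1 (hq (QuotientGroup.mk ⟨s, hsA⟩))
  have hd0 : d ≠ 0 := by
    rintro rfl
    rw [zpow_zero] at hd
    exact hsB (Subgroup.mem_subgroupOf.1 ((QuotientGroup.eq_one_iff _).1 hd.symm))
  refine ⟨d.natAbs, x, Int.natAbs_pos.2 hd0, fun y hy => ?_⟩
  obtain ⟨w, hw⟩ := Subgroup.mem_zpowers_iff.1 (hq (QuotientGroup.mk ⟨y, hy⟩))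
  have h1 := Int.emod_nonneg w hd0
  have h2 := Int.emod_lt_abs w hd0
  rw [Int.abs_eq_natAbs] at h2
  refine ⟨(w % d).toNat, by omega, w / d, ?_⟩
  have h : (QuotientGroup.mk (x ^ (w % d).toNat * ⟨s, hsA⟩ ^ (w / d)) : A ⧸ B.subgroupOf A) =
      QuotientGroup.mk ⟨y, hy⟩ := by
    rw [QuotientGroup.mk_mul, QuotientGroup.mk_pow, QuotientGroup.mk_zpow, ← hw, ← hd,
      ← zpow_natCast, Int.toNat_of_nonneg h1, ← zpow_mul, ← zpow_add, Int.emod_add_mul_ediv]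
  have := Subgroup.mem_subgroupOf.1 (QuotientGroup.eq.1 h)
  simpa using this

end Index

/-! ### The index of the product and the growth bound -/

section IndexBound

open Classical in
/-- The index of the product of the power subgroups of a terraced filtration. -/
theorem IsTerrace.exists_card_quotient_powProduct_le {G : Type*} [Group G] [Group.IsNilpotent G]
    {c : ℕ} {H : ℕ → Subgroup G} (hH : IsTerrace c H) (X : Finset G)
    (hX : Subgroup.closure (X : Set G) = ⊤) :
    ∃ D E : ℕ, 0 < D ∧ E + ∑ l ∈ Finset.range c, groupDim (H l) ≤ c * groupDim G ∧
      ∀ q, 0 < q → Finite (G ⧸ powProduct H q c) ∧ Nat.card (G ⧸ powProduct H q c) ≤ D * q ^ E := by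
  have hne : {d : ℕ | ∃ (n : ℕ) (S : ℕ → Subgroup G), IsCyclicSeries n S ∧
      ((Finset.range n).filter
        fun i => Infinite (S i ⧸ (S (i + 1)).subgroupOf (S i))).card = d}.Nonempty := by
    obtain ⟨n, S, hS⟩ := exists_isCyclicSeries X hX
    exact ⟨_, n, S, hS, rfl⟩
  obtain ⟨n, S, hS, hcard⟩ := Nat.sInf_mem hne
  change _ = groupDim G at hcard
  set J := (Finset.range n).filter fun i => Infinite (S i ⧸ (S (i + 1)).subgroupOf (S i)) with hJ
  have hlevel : ∀ j ∈ J, ∃ i, ¬ S j ⊓ H i ≤ S (j + 1) := by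
    intro j hj
    rw [hJ, Finset.mem_filter, Finset.mem_range] at hj
    refine ⟨c, fun hle => ?_⟩
    rw [hH.last_eq, inf_top_eq] at hle
    have hsub : Subsingleton (S j ⧸ (S (j + 1)).subgroupOf (S j)) := by
      rw [Subgroup.subgroupOf_eq_top.2 hle]
      exact QuotientGroup.subsingleton_quotient_top
    have := hj.2
    exact not_finite (S j ⧸ (S (j + 1)).subgroupOf (S j))
  -- The first terrace that is nontrivial in the factor `j`. On `J` it exists because `H c = G`; the
  -- value `0` is a dummy.
  let lev : ℕ → ℕ := fun j => if h : ∃ i, ¬ S j ⊓ H i ≤ S (j + 1) then Nat.find h else 0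
  have hlev : ∀ j ∈ J, ¬ S j ⊓ H (lev j) ≤ S (j + 1) := fun j hj => by
    simp only [lev, dif_pos (hlevel j hj)]
    exact Nat.find_spec (hlevel j hj)
  have hlev_le : ∀ j ∈ J, ∀ i, ¬ S j ⊓ H i ≤ S (j + 1) → lev j ≤ i := fun j hj i hi => by
    simp only [lev, dif_pos (hlevel j hj)]
    exact Nat.find_min' _ hi
  have hlev_c : ∀ j ∈ J, lev j ≤ c := fun j hj => by
    by_contra! hlt
    have : S j ⊓ H c ≤ S (j + 1) := by
      by_contra h
      exact absurd (hlev_le j hj c h) (not_le.2 hlt)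
    refine hlev j hj (le_trans ?_ this)
    rw [hH.last_eq, inf_top_eq]
    exact inf_le_left
  have hlev_pos : ∀ j ∈ J, 0 < lev j := fun j hj => by
    refine Nat.pos_of_ne_zero fun h0 => hlev j hj ?_
    rw [h0, hH.zero_eq, inf_bot_eq]
    exact bot_le
  have hfactor : ∀ j, ∃ d : ℕ, 0 < d ∧ (j < n → ∃ x s : G,
      (j ∈ J → s ∈ H (lev j)) ∧ (j ∉ J → s = 1) ∧
        ∀ y ∈ S j, ∃ r < d, ∃ z : ℤ, (s ^ z)⁻¹ * (x ^ r)⁻¹ * y ∈ S (j + 1)) := by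
    intro j
    by_cases hj : j < n
    swap
    · exact ⟨1, one_pos, fun h => absurd h hj⟩
    obtain ⟨_, _⟩ := hS.cyclic j hj
    by_cases hjJ : j ∈ J
    · obtain ⟨s, hs, hs'⟩ := SetLike.not_le_iff_exists.1 (hlev j hjJ)
      obtain ⟨d, x, hd, h⟩ := exists_forall_exists_zpow_of_infinite hs.1 hs'
      exact ⟨d, hd, fun _ => ⟨x, s, fun _ => hs.2, fun h => absurd hjJ h, h⟩⟩
    · have : Finite (S j ⧸ (S (j + 1)).subgroupOf (S j)) := by
        rw [← not_infinite_iff_finite]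
        exact fun h => hjJ (Finset.mem_filter.2 ⟨Finset.mem_range.2 hj, h⟩)
      obtain ⟨d, x, hd, h⟩ := exists_forall_exists_pow_of_finite (A := S j) (B := S (j + 1))
      refine ⟨d, hd, fun _ => ⟨x, 1, fun h => absurd h hjJ, fun _ => rfl, fun y hy => ?_⟩⟩
      obtain ⟨r, hr, h⟩ := h y hy
      exact ⟨r, hr, 0, by simpa using h⟩
  choose d hd hfactor using hfactor
  refine ⟨∏ j ∈ Finset.range n, d j, ∑ j ∈ J, lev j, Finset.prod_pos fun j _ => hd j, ?_, ?_⟩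
  -- Double counting: the sum of the levels is the sum over `l < c` of the number of factors with
  -- level above `l`, and at least `groupDim (H l)` factors have level at most `l`.
  · have h1 : ∀ j ∈ J, lev j = ∑ l ∈ Finset.range c, if l < lev j then 1 else 0 := fun j hj => by
      rw [Finset.sum_boole, Nat.cast_id]
      have : (Finset.range c).filter (· < lev j) = Finset.range (lev j) := by
        ext l
        have := hlev_c j hj
        simp only [Finset.mem_filter, Finset.mem_range]
        omega
      rw [this, Finset.card_range]
    have h2 : ∑ j ∈ J, lev j = ∑ l ∈ Finset.range c, (J.filter fun j => l < lev j).card := by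
      rw [Finset.sum_congr rfl h1, Finset.sum_comm]
      exact Finset.sum_congr rfl fun l _ => by rw [Finset.sum_boole, Nat.cast_id]
    rw [h2, ← Finset.sum_add_distrib]
    have h3 : ∀ l ∈ Finset.range c,
        (J.filter fun j => l < lev j).card + groupDim (H l) ≤ groupDim G := by
      intro l _
      have h4 : groupDim (H l) ≤ (J.filter fun j => ¬ l < lev j).card := by
        refine (groupDim_le_card hS (H l)).trans (Finset.card_le_card fun j hj => ?_)
        rw [Finset.mem_filter] at hj ⊢
        exact ⟨hj.1, not_lt.2 (hlev_le j hj.1 l hj.2)⟩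
      rw [← hcard, ← Finset.card_filter_add_card_filter_not (s := J) (fun j => l < lev j)]
      exact Nat.add_le_add_left h4 _
    refine (Finset.sum_le_sum h3).trans ?_
    simp
  · intro q hq
    set N := powProduct H q c
    have hN : N.Normal := powProduct_normal q hH.normal
    let w : ℕ → ℕ := fun j => if j ∈ J then q ^ lev j else 1
    have hw : ∀ j, 0 < w j := fun j => by
      simp only [w]
      split_ifs <;> positivity
    have key : ∀ k ≤ n, Finite ((S (n - k)).map (QuotientGroup.mk' N)) ∧
        Nat.card ((S (n - k)).map (QuotientGroup.mk' N)) ≤ ∏ j ∈ Finset.Ico (n - k) n, d j * w j := by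
      intro k
      induction k with
      | zero =>
        intro _
        rw [Nat.sub_zero, hS.last_eq, Subgroup.map_bot]
        exact ⟨inferInstance, by simp⟩
      | succ k ih =>
        intro hk
        obtain ⟨hfin, hle⟩ := ih (by omega)
        set j := n - (k + 1) with hj
        rw [show n - k = j + 1 by omega] at hfin hle
        obtain ⟨x, s, hs, hs', h⟩ := hfactor j (by omega)
        have hsN : (QuotientGroup.mk' N s) ^ w j = 1 := by
          rw [← map_pow]
          refine (QuotientGroup.eq_one_iff _).2 ?_
          by_cases hjJ : j ∈ J
          · simp only [w, if_pos hjJ]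
            exact powSubgroup_le_powProduct H q (hlev_pos j hjJ) (hlev_c j hjJ)
              (pow_mem_powSubgroup (hs hjJ))
          · rw [hs' hjJ, one_pow]
            exact one_mem _
        obtain ⟨h1, h2⟩ := natCard_le_of_forall_exists hfin (A := (S j).map (QuotientGroup.mk' N))
          (x := QuotientGroup.mk' N x) (d := d j) (hw j) hsN (by
            rintro _ ⟨y, hy, rfl⟩
            obtain ⟨r, hr, z, hz⟩ := h y hy
            exact ⟨r, hr, z, _, hz, by simp⟩)
        refine ⟨h1, h2.trans ?_⟩
        rw [Finset.prod_eq_prod_Ico_succ_bot (by omega)]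
        exact Nat.mul_le_mul_left _ hle
    obtain ⟨h1, h2⟩ := key n le_rfl
    rw [Nat.sub_self, hS.zero_eq, ← MonoidHom.range_eq_map, QuotientGroup.range_mk'] at h1 h2
    refine ⟨(Subgroup.topEquiv (G := G ⧸ N)).toEquiv.finite_iff.1 h1, ?_⟩
    rw [Nat.card_congr (Subgroup.topEquiv (G := G ⧸ N)).toEquiv] at h2
    refine h2.trans (le_of_eq ?_)
    rw [← Finset.range_eq_Ico, Finset.prod_mul_distrib]
    congr 1
    rw [← Finset.prod_pow_eq_pow_sum, Finset.prod_ite, Finset.prod_const_one, mul_one]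
    refine Finset.prod_congr ?_ fun _ _ => rfl
    ext j
    simp only [hJ, Finset.mem_filter]
    tauto

/-- Two elements of the ball of radius `n` differ by one of the ball of radius `2n`. `Shrink` moves
the finite quotient to `Type`. -/
theorem fullRFGrowth_le {G : Type*} [Group G] (X : Finset G) (n : ℕ) (N : Subgroup G) [N.Normal]
    [Finite (G ⧸ N)] (h : ∀ g ∈ wordBall X (n + n), g ∈ N → g = 1) :
    fullRFGrowth X n ≤ Nat.card (G ⧸ N) := by
  let f : Shrink.{0} (G ⧸ N) ≃* G ⧸ N := Shrink.mulEquiv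
  refine sInf_le ⟨Shrink.{0} (G ⧸ N), inferInstance,
    ⟨f.symm.toMonoidHom.comp (QuotientGroup.mk' N), fun g hg g' hg' hgg => ?_⟩, ?_⟩
  · have h1 : (QuotientGroup.mk g : G ⧸ N) = QuotientGroup.mk g' := f.symm.injective hgg
    exact inv_mul_eq_one.1
      (h _ (mul_mem_wordBall (inv_mem_wordBall hg) hg') (QuotientGroup.eq.1 h1))
  · rw [ENat.card_congr f.toEquiv, ENat.card_eq_coe_natCard]

theorem growthLE_of_isTerrace {G : Type*} [Group G] [Group.IsNilpotent G] {c : ℕ}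
    {H : ℕ → Subgroup G} (hH : IsTerrace c H) (X : Finset G)
    (hX : Subgroup.closure (X : Set G) = ⊤)
    (hc : (⊤ : Subgroup G).lowerCentralSeries c = ⊥) {F : ℤ}
    (hF : (c : ℤ) * groupDim G - ∑ l ∈ Finset.range c, (groupDim (H l) : ℤ) ≤ F) :
    GrowthLE (fun n => (fullRFGrowth X n : ℝ≥0∞)) fun n => (n : ℝ≥0∞) ^ F := by
  obtain ⟨D, E, hD, hE, hindex⟩ := hH.exists_card_quotient_powProduct_le X hX
  obtain ⟨K, e, C, hK, he, htriv⟩ := hH.exists_powProduct_inter_wordBall X hX hc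
  set B := D * (K * (e * (2 * C + 1)))
  have hB : 0 < B := by positivity
  refine ⟨B, hB, fun n hn => ?_⟩
  -- Divisible by `e`, larger than `C * (2 * n)`, and linear in `n`.
  set m := e * ((2 * C + 1) * n)
  have hN := powProduct_normal (K * m) hH.normal
  obtain ⟨_, hcard⟩ := hindex (K * m) (by positivity)
  have h1 : fullRFGrowth X n ≤ Nat.card (G ⧸ powProduct H (K * m) c) :=
    fullRFGrowth_le X n _ fun g hg hgN => htriv m (n + n) (by omega) (dvd_mul_right _ _) (by
      calc C * (n + n) < (2 * C + 1) * n := by nlinarith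
        _ ≤ m := Nat.le_mul_of_pos_left _ he) g hg hgN
  have h2 : Nat.card (G ⧸ powProduct H (K * m) c) ≤ B * (B * n) ^ E := by
    refine hcard.trans (Nat.mul_le_mul ?_ (Nat.pow_le_pow_left ?_ E))
    · exact Nat.le_mul_of_pos_right _ (by positivity)
    · calc K * m = K * (e * (2 * C + 1)) * n := by simp only [m]; ring
        _ ≤ B * n := Nat.mul_le_mul_right _ (Nat.le_mul_of_pos_left _ hD)
  have h3 : (E : ℤ) ≤ F := by
    refine le_trans ?_ hF
    rw [le_sub_iff_add_le]
    exact_mod_cast hE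
  obtain ⟨F, rfl⟩ := Int.eq_ofNat_of_zero_le ((Int.natCast_nonneg E).trans h3)
  have h4 : B * (B * n) ^ E ≤ B * (B * n) ^ F :=
    Nat.mul_le_mul_left _ (Nat.pow_le_pow_right (by positivity) (by exact_mod_cast h3))
  have h5 : fullRFGrowth X n ≤ ((B * (B * n) ^ F : ℕ) : ℕ∞) :=
    h1.trans (by exact_mod_cast h2.trans h4)
  calc (fullRFGrowth X n : ℝ≥0∞) ≤ (((B * (B * n) ^ F : ℕ) : ℕ∞) : ℝ≥0∞) := by
        exact_mod_cast h5
    _ = _ := by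
        simp only [zpow_natCast]
        simp

end IndexBound

theorem theoremB {G : Type*} [Group G] [Group.IsNilpotent G]
    (X : Finset G) (hX : Subgroup.closure (X : Set G) = ⊤)
    (c : ℕ) (hc : Group.nilpotencyClass G = c)
    (H : ℕ → Subgroup G) (hH : IsTerracedFiltration c H) :
    GrowthLE (fun n => (fullRFGrowth X n : ℝ≥0∞))
      (fun n => (n : ℝ≥0∞) ^
        ((c : ℤ) * groupDim G - ∑ i ∈ Finset.Ico 1 c, (groupDim (H i) : ℤ))) := by
  have hlcs : (⊤ : Subgroup G).lowerCentralSeries c = ⊥ :=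
    Subgroup.lowerCentralSeries_eq_bot_iff_nilpotencyClass_le.2 hc.le
  rcases Nat.eq_zero_or_pos c with rfl | hc0
  -- For `c = 0` the conditions `H 0 = ⊥` and `H c = ⊤` concern the same index; they agree because
  -- `G` is trivial.
  · have hbot : ∀ K : Subgroup G, K = ⊥ := fun K => le_bot_iff.1 (le_top.trans hlcs.le)
    have hT : IsTerrace 0 fun _ : ℕ => (⊥ : Subgroup G) :=
      { zero_eq := rfl
        last_eq := (hbot ⊤).symm
        le_succ := fun _ _ => le_rfl
        normal := fun _ _ => inferInstance
        inf_eq_bot := fun _ _ => bot_inf_eq _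
        le_of_inf_eq_bot := fun i hi => absurd hi (Nat.not_lt_zero i) }
    exact growthLE_of_isTerrace hT X hX hlcs (by simp)
  · have hT : IsTerrace c fun i => if i < c then H i else ⊤ :=
      { zero_eq := by simp [hc0, hH.zero_eq]
        last_eq := by simp
        le_succ := fun i hi => by
          by_cases h : i + 1 < c
          · simpa [hi, h] using hH.le_succ i h
          · simp [h]
        normal := fun i hi => by
          by_cases h : i < c
          · simpa [h] using (hH.maximal i h).prop.1
          · simp only [h, if_false]; infer_instance
        inf_eq_bot := fun i hi => by
          by_cases h : i < c
          · simpa [h] using (hH.maximal i h).prop.2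
          · obtain rfl : i = c := by omega
            simp [hlcs]
        le_of_inf_eq_bot := fun i hi K hK hKi hle => by
          simp only [hi, if_true] at hle ⊢
          exact (hH.maximal i hi).le_of_ge ⟨hK, hKi⟩ hle }
    refine growthLE_of_isTerrace hT X hX hlcs ?_
    -- Adding the term of `H 0` only enlarges the subtracted sum, so its dimension need not be
    -- computed.
    refine sub_le_sub_left ?_ _
    rw [Finset.range_eq_Ico]
    refine (Finset.sum_le_sum_of_subset_of_nonneg (Finset.Ico_subset_Ico_left (Nat.zero_le 1))
      fun _ _ _ => Int.natCast_nonneg _).trans' (le_of_eq (Finset.sum_congr rfl fun i hi => ?_))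
    rw [if_pos (Finset.mem_Ico.1 hi).2]
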